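/- Let $F$ be a totally real number field of degree $d>1$ with ring of integers $\mathcal O$, different $\mathfrak d$ and real embeddings $\sigma_1,\dots,\sigma_d$; write $x_i=\sigma_i(x)$ for $x\in F$, call $x$ totally positive if $x_i>0$ for all $i$, and let $S^+$ denote the set of totally positive elements of $S\subset F$. Let $\mathfrak c$ be a nonzero fractional ideal and $\mathfrak n$ a nonzero integral ideal of $F$, and let $$\Gamma=\Gamma_0(\mathfrak c,\mathfrak n)=\left\{\begin{pmatrix}a&b\\c&d\end{pmatrix}: a,d\in\mathcal O,\ b\in(\mathfrak{cd})^{-1},\ c\in\mathfrak{cnd},\ ad-bc\in\mathcal O^{\times+}\right\},$$ $$\Gamma_\infty=\left\{\begin{pmatrix}\varepsilon&0\\0&1\end{pmatrix}\begin{pmatrix}\eta&0\\0&\eta\end{pmatrix}\begin{pmatrix}1&b\\0&1\end{pmatrix}:\ \varepsilon\in\mathcal O^{\times+},\ \eta\in\mathcal O^\times,\ b\in(\mathfrak{cd})^{-1}\right\}\subset\Gamma .$$ Let $\mathbf k=(k_1,\dots,k_d)\in\mathbb Z^d$ with $k_i>2$ for all $i$. For $\phi:\mathbb H^d\to\mathbb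 C$ and $M=\begin{pmatrix}a&b\\c&d\end{pmatrix}\in\Gamma$ put $$(\phi|_{\mathbf k}M)(z)=\prod_{i=1}^d \det(M)_i^{k_i/2}(c_iz_i+d_i)^{-k_i}\cdot\phi(Mz),\qquad Mz=\left(\frac{a_iz_i+b_i}{c_iz_i+d_i}\right)_i .$$ Let $\phi:\mathbb H^d\to\mathbb C$ be given by a convergent Fourier series $$\phi(z)=\sum_{\nu\in\mathfrak c^+\cup\{0\}}a_\nu\exp\Big(2\pi i\sum_{i}\nu_iz_i\Big)\qquad(z\in\mathbb H^d),$$ where convergence means absolute convergence at every point, and assume that $\phi|_{\mathbf k}M=\phi$ for all $M\in\Gamma_\infty$. Suppose that for some real $\varepsilon>0$ $$a_\nu=O\big(N(\nu)^{\frac{\mathbf k}2-2-\varepsilon}\big)\qquad(\nu\in\mathfrak c^+),\qquad N(\nu)^{\frac{\mathbf k}2-2-\varepsilon}:=\prod_{i=1}^d\nu_i^{\frac{k_i}2-2-\varepsilon},$$ that is, there is a constant $C$ with $|a_\nu|\le C\prod_i\nu_i^{k_i/2-2-\varepsilon}$ for all $\nu\in\mathfrak c^+$. Then the Hilbert Poincaré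 series $$\mathbb P_{\mathbf k}(\phi;z)=\sum_{M\in\Gamma_\infty\backslash\Gamma}(\phi|_{\mathbf k}M)(z)$$ converges absolutely at every $z\in\mathbb H^d$, and it converges locally uniformly on $\mathbb H^d$. -/

import Mathlib

set_option linter.unusedSectionVars false

open scoped nonZeroDivisors NumberField UpperHalfPlane MatrixGroups

noncomputable section

namespace HilbertPoincare

variable {F : Type*} [Field F] [NumberField F]

/-- The fractional ideal `𝔠𝔡`, where `𝔡` is the different of `F`. -/
def idealCD (c : FractionalIdeal (𝓞 F)⁰ F) : FractionalIdeal (𝓞 F)⁰ F :=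
  c * (differentIdeal ℤ (𝓞 F) : FractionalIdeal (𝓞 F)⁰ F)

/-- `x` is totally positive: every real embedding of `F` sends it to a positive number. -/
def TotallyPositive (x : F) : Prop := ∀ σ : F →+* ℝ, 0 < σ x

/-- `x ∈ 𝒪ˣ`, for an element `x` of `F`. -/
def IsIntegralUnit (x : F) : Prop := ∃ u : (𝓞 F)ˣ, ((u : 𝓞 F) : F) = x

/-- `x ∈ 𝒪ˣ⁺`, for an element `x` of `F`. -/
def IsTotPosUnit (x : F) : Prop := IsIntegralUnit x ∧ TotallyPositive x

lemma IsIntegralUnit.one : IsIntegralUnit (1 : F) := ⟨1, by simp⟩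

lemma IsIntegralUnit.mul {x y : F} (hx : IsIntegralUnit x) (hy : IsIntegralUnit y) :
    IsIntegralUnit (x * y) := by
  obtain ⟨u, rfl⟩ := hx
  obtain ⟨v, rfl⟩ := hy
  exact ⟨u * v, by simp⟩

lemma IsIntegralUnit.ne_zero {x : F} (hx : IsIntegralUnit x) : x ≠ 0 := by
  obtain ⟨u, rfl⟩ := hx
  simp

lemma IsIntegralUnit.inv {x : F} (hx : IsIntegralUnit x) : IsIntegralUnit x⁻¹ := by
  have h0 := hx.ne_zero
  obtain ⟨u, rfl⟩ := hx
  refine ⟨u⁻¹, eq_inv_of_mul_eq_one_left ?_⟩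
  rw [← map_mul, Units.inv_mul, map_one]

lemma IsIntegralUnit.mem_range {x : F} (hx : IsIntegralUnit x) :
    x ∈ (algebraMap (𝓞 F) F).range := by
  obtain ⟨u, rfl⟩ := hx
  exact ⟨u, rfl⟩

lemma IsTotPosUnit.one : IsTotPosUnit (1 : F) := ⟨.one, fun σ => by simp⟩

lemma IsTotPosUnit.mul {x y : F} (hx : IsTotPosUnit x) (hy : IsTotPosUnit y) :
    IsTotPosUnit (x * y) :=
  ⟨hx.1.mul hy.1, fun σ => by rw [map_mul]; exact mul_pos (hx.2 σ) (hy.2 σ)⟩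

lemma IsTotPosUnit.inv {x : F} (hx : IsTotPosUnit x) : IsTotPosUnit x⁻¹ :=
  ⟨hx.1.inv, fun σ => by rw [map_inv₀]; exact inv_pos.mpr (hx.2 σ)⟩

lemma int_mul_mem {I : FractionalIdeal (𝓞 F)⁰ F} {r x : F}
    (hr : r ∈ (algebraMap (𝓞 F) F).range) (hx : x ∈ I) : r * x ∈ I := by
  obtain ⟨s, rfl⟩ := hr
  rw [← Algebra.smul_def]
  exact (I : Submodule (𝓞 F) F).smul_mem s hx

lemma add_mem_ideal {I : FractionalIdeal (𝓞 F)⁰ F} {x y : F} (hx : x ∈ I) (hy : y ∈ I) :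
    x + y ∈ I := (I : Submodule (𝓞 F) F).add_mem hx hy

lemma neg_mem_ideal {I : FractionalIdeal (𝓞 F)⁰ F} {x : F} (hx : x ∈ I) : -x ∈ I :=
  (I : Submodule (𝓞 F) F).neg_mem hx

lemma zero_mem_ideal {I : FractionalIdeal (𝓞 F)⁰ F} : (0 : F) ∈ I :=
  (I : Submodule (𝓞 F) F).zero_mem

lemma inv_mul_mem_range {c : FractionalIdeal (𝓞 F)⁰ F} {n : Ideal (𝓞 F)} {x y : F}
    (hx : x ∈ (idealCD c)⁻¹) (hy : y ∈ idealCD c * (n : FractionalIdeal (𝓞 F)⁰ F)) :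
    x * y ∈ (algebraMap (𝓞 F) F).range := by
  have hy' : y ∈ idealCD c := by
    have hle : idealCD c * (n : FractionalIdeal (𝓞 F)⁰ F) ≤ idealCD c * 1 :=
      mul_le_mul_right FractionalIdeal.coeIdeal_le_one _
    rw [mul_one] at hle
    exact hle hy
  have h1 : x * y ∈ (idealCD c)⁻¹ * idealCD c := FractionalIdeal.mul_mem_mul hx hy'
  by_cases h0 : idealCD c = 0
  · rw [h0, mul_zero, FractionalIdeal.mem_zero_iff] at h1
    rw [h1]
    exact zero_mem _
  · rw [inv_mul_cancel₀ h0, FractionalIdeal.mem_one_iff] at h1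
    exact h1

lemma gl_inv_entries (M : GL (Fin 2) F) :
    (M⁻¹ : GL (Fin 2) F) 0 0 = (M.1.det)⁻¹ * M 1 1 ∧
    (M⁻¹ : GL (Fin 2) F) 0 1 = (M.1.det)⁻¹ * -M 0 1 ∧
    (M⁻¹ : GL (Fin 2) F) 1 0 = (M.1.det)⁻¹ * -M 1 0 ∧
    (M⁻¹ : GL (Fin 2) F) 1 1 = (M.1.det)⁻¹ * M 0 0 := by
  rw [Matrix.coe_units_inv, Matrix.inv_def, Matrix.adjugate_fin_two, Ring.inverse_eq_inv']
  simp

/-- The congruence subgroup `Γ₀(𝔠, 𝔫)` of `GL₂(F)`: matrices with diagonal entries in `𝒪`,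
upper right entry in `(𝔠𝔡)⁻¹`, lower left entry in `𝔠𝔫𝔡` and determinant in `𝒪ˣ⁺`. -/
def Gamma0 (c : FractionalIdeal (𝓞 F)⁰ F) (n : Ideal (𝓞 F)) : Subgroup (GL (Fin 2) F) where
  carrier := {M |
    M 0 0 ∈ (algebraMap (𝓞 F) F).range ∧ M 1 1 ∈ (algebraMap (𝓞 F) F).range ∧
    M 0 1 ∈ (idealCD c)⁻¹ ∧ M 1 0 ∈ idealCD c * (n : FractionalIdeal (𝓞 F)⁰ F) ∧
    IsTotPosUnit M.1.det}
  one_mem' := by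
    refine ⟨by simp, by simp, ?_, ?_, ?_⟩
    · simpa using zero_mem_ideal
    · simpa using zero_mem_ideal
    · simpa using IsTotPosUnit.one
  mul_mem' := by
    rintro M M' ⟨ha, hd, hb, hc, hdet⟩ ⟨ha', hd', hb', hc', hdet'⟩
    refine ⟨?_, ?_, ?_, ?_, ?_⟩
    · rw [Units.val_mul, Matrix.mul_apply, Fin.sum_univ_two]
      exact add_mem (mul_mem ha ha') (inv_mul_mem_range hb hc')
    · rw [Units.val_mul, Matrix.mul_apply, Fin.sum_univ_two, mul_comm (M.1 1 0)]
      exact add_mem (inv_mul_mem_range hb' hc) (mul_mem hd hd')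
    · rw [Units.val_mul, Matrix.mul_apply, Fin.sum_univ_two, mul_comm (M.1 0 1)]
      exact add_mem_ideal (int_mul_mem ha hb') (int_mul_mem hd' hb)
    · rw [Units.val_mul, Matrix.mul_apply, Fin.sum_univ_two, mul_comm (M.1 1 0)]
      exact add_mem_ideal (int_mul_mem ha' hc) (int_mul_mem hd hc')
    · rw [Units.val_mul, Matrix.det_mul]
      exact hdet.mul hdet'
  inv_mem' := by
    rintro M ⟨ha, hd, hb, hc, hdet⟩
    obtain ⟨e1, e2, e3, e4⟩ := gl_inv_entries M
    have hi := hdet.inv.1.mem_range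
    refine ⟨?_, ?_, ?_, ?_, ?_⟩
    · rw [e1]; exact mul_mem hi hd
    · rw [e4]; exact mul_mem hi ha
    · rw [e2]; exact int_mul_mem hi (neg_mem_ideal hb)
    · rw [e3]; exact int_mul_mem hi (neg_mem_ideal hc)
    · rw [Matrix.coe_units_inv, Matrix.det_nonsing_inv, Ring.inverse_eq_inv']
      exact hdet.inv

variable (F) in
/-- The matrices `diag(ε, 1)` with `ε ∈ 𝒪ˣ⁺`. -/
def cuspU : Set (GL (Fin 2) F) := {M | ∃ e : F, IsTotPosUnit e ∧ M.1 = !![e, 0; 0, 1]}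

variable (F) in
/-- The scalar matrices `diag(ε, ε)` with `ε ∈ 𝒪ˣ`. -/
def cuspZ : Set (GL (Fin 2) F) := {M | ∃ e : F, IsIntegralUnit e ∧ M.1 = !![e, 0; 0, e]}

/-- The translations by elements of `(𝔠𝔡)⁻¹`. -/
def cuspN (c : FractionalIdeal (𝓞 F)⁰ F) : Set (GL (Fin 2) F) :=
  {M | ∃ b : F, b ∈ (idealCD c)⁻¹ ∧ M.1 = !![1, b; 0, 1]}

lemma exists_cusp_iff (c : FractionalIdeal (𝓞 F)⁰ F) (M : GL (Fin 2) F) :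
    (∃ u ∈ cuspU F, ∃ z ∈ cuspZ F, ∃ t ∈ cuspN c, M = u * z * t) ↔
    ∃ e h b : F, IsTotPosUnit e ∧ IsIntegralUnit h ∧ b ∈ (idealCD c)⁻¹ ∧
      M.1 = !![e * h, e * h * b; 0, h] := by
  constructor
  · rintro ⟨u, ⟨e, he, hu⟩, z, ⟨h, hh, hz⟩, t, ⟨b, hb, ht⟩, rfl⟩
    refine ⟨e, h, b, he, hh, hb, ?_⟩
    rw [Units.val_mul, Units.val_mul, hu, hz, ht]
    simp
  · rintro ⟨e, h, b, he, hh, hb, hM⟩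
    have he0 := he.1.ne_zero
    have hh0 := hh.ne_zero
    refine ⟨Matrix.GeneralLinearGroup.mkOfDetNeZero !![e, 0; 0, 1] (by simpa using he0),
      ⟨e, he, rfl⟩,
      Matrix.GeneralLinearGroup.mkOfDetNeZero !![h, 0; 0, h] (by simpa using hh0),
      ⟨h, hh, rfl⟩,
      Matrix.GeneralLinearGroup.mkOfDetNeZero !![1, b; 0, 1] (by simp),
      ⟨b, hb, rfl⟩, ?_⟩
    apply Units.ext
    rw [hM]
    change _ = !![e, 0; 0, 1] * !![h, 0; 0, h] * !![1, b; 0, 1]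
    simp

/-- The parabolic subgroup `Γ_∞ = U(Γ) Z(Γ) N(Γ)` of `Γ₀(𝔠, 𝔫)` (it does not depend on `𝔫`). -/
def GammaInfty (c : FractionalIdeal (𝓞 F)⁰ F) : Subgroup (GL (Fin 2) F) where
  carrier := {M | ∃ u ∈ cuspU F, ∃ z ∈ cuspZ F, ∃ t ∈ cuspN c, M = u * z * t}
  one_mem' := by
    refine (exists_cusp_iff c 1).mpr ⟨1, 1, 0, .one, .one, zero_mem_ideal, ?_⟩
    simp [Matrix.one_fin_two]
  mul_mem' := by
    intro M M' hM hM'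
    obtain ⟨e, h, b, he, hh, hb, e1⟩ := (exists_cusp_iff c M).mp hM
    obtain ⟨e', h', b', he', hh', hb', e2⟩ := (exists_cusp_iff c M').mp hM'
    refine (exists_cusp_iff c (M * M')).mpr ⟨e * e', h * h', b' + e'⁻¹ * b, he.mul he',
      hh.mul hh', add_mem_ideal hb' (int_mul_mem he'.inv.1.mem_range hb), ?_⟩
    have := he'.1.ne_zero
    rw [Units.val_mul, e1, e2]
    ext i j
    fin_cases i <;> fin_cases j <;> simp [Matrix.mul_apply, Fin.sum_univ_two] <;>
      field_simp
  inv_mem' := by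
    intro M hM
    obtain ⟨e, h, b, he, hh, hb, e1⟩ := (exists_cusp_iff c M).mp hM
    refine (exists_cusp_iff c M⁻¹).mpr ⟨e⁻¹, h⁻¹, -(e * b), he.inv, hh.inv,
      neg_mem_ideal (int_mul_mem he.1.mem_range hb), ?_⟩
    have h1 := he.1.ne_zero
    have h2 := hh.ne_zero
    rw [Matrix.coe_units_inv, e1]
    apply Matrix.inv_eq_left_inv
    ext i j
    fin_cases i <;> fin_cases j <;> simp [Matrix.mul_apply, Fin.sum_univ_two] <;>
      field_simp
    simp

lemma GammaInfty_le (c : FractionalIdeal (𝓞 F)⁰ F) (n : Ideal (𝓞 F)) :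
    GammaInfty c ≤ Gamma0 c n := by
  intro M hM
  obtain ⟨e, h, b, he, hh, hb, e1⟩ := (exists_cusp_iff c M).mp hM
  have hr := (he.1.mul hh).mem_range
  refine ⟨?_, ?_, ?_, ?_, ?_⟩
  · rw [e1]; exact hr
  · rw [e1]; exact hh.mem_range
  · rw [e1]; exact int_mul_mem hr hb
  · rw [e1]; exact zero_mem_ideal
  · rw [e1, Matrix.det_fin_two_of]
    refine ⟨by simpa using (he.1.mul hh).mul hh, fun σ => ?_⟩
    have h0 : σ h ≠ 0 := (map_ne_zero σ).mpr hh.ne_zero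
    have : σ (e * h * h - e * h * b * 0) = σ e * (σ h * σ h) := by
      rw [mul_zero, sub_zero, map_mul, map_mul, mul_assoc]
    rw [this]
    exact mul_pos (he.2 σ) (mul_self_pos.mpr h0)

variable (F) in
/-- `ℍ^d`, with one coordinate for each real embedding of `F`. -/
abbrev HilbertHalfSpace : Type _ := (F →+* ℝ) → ℍ

/-- The image of `M ∈ GL₂(F)` in `GL₂(ℝ)` under a real embedding of `F`. -/
def realize (σ : F →+* ℝ) : GL (Fin 2) F →* GL (Fin 2) ℝ := Matrix.GeneralLinearGroup.map σ

/-- The componentwise Möbius transformation (for `M` with totally positive determinant). -/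
def moebius (M : GL (Fin 2) F) (z : HilbertHalfSpace F) : HilbertHalfSpace F :=
  fun σ => realize σ M • z σ

/-- The factor `det(M)^{𝐤/2} N(cz+d)^{-𝐤} = ∏ σ(det M)^{k_σ/2} (σ(c) z_σ + σ(d))^{-k_σ}`. -/
def autFactor (k : (F →+* ℝ) → ℤ) (M : GL (Fin 2) F) (z : HilbertHalfSpace F) : ℂ :=
  ∏ σ : F →+* ℝ, (((σ M.1.det) ^ ((k σ : ℝ) / 2) : ℝ) : ℂ) *
    ((σ (M 1 0) : ℂ) * (z σ : ℂ) + (σ (M 1 1) : ℂ)) ^ (-(k σ))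

/-- The weight `𝐤` slash operator `φ |_𝐤 M` (for `M` with totally positive determinant). -/
def slash (k : (F →+* ℝ) → ℤ) (φ : HilbertHalfSpace F → ℂ) (M : GL (Fin 2) F) :
    HilbertHalfSpace F → ℂ :=
  fun z => autFactor k M z * φ (moebius M z)

lemma realize_det_pos {M : GL (Fin 2) F} (hM : TotallyPositive M.1.det) (σ : F →+* ℝ) :
    0 < (realize σ M).det.val := by
  have : (realize σ M).det.val = σ M.1.det := by
    rw [RingHom.map_det]; rfl
  rw [this]
  exact hM σ

lemma moebius_mul (M N : GL (Fin 2) F) (z : HilbertHalfSpace F) :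
    moebius (M * N) z = moebius M (moebius N z) := by
  funext σ
  simp only [moebius, map_mul, mul_smul]

lemma autFactor_mul (k : (F →+* ℝ) → ℤ) {M N : GL (Fin 2) F}
    (hM : TotallyPositive M.1.det) (hN : TotallyPositive N.1.det) (z : HilbertHalfSpace F) :
    autFactor k (M * N) z = autFactor k N z * autFactor k M (moebius N z) := by
  unfold autFactor
  rw [← Finset.prod_mul_distrib]
  refine Finset.prod_congr rfl fun σ _ => ?_
  have h1 := UpperHalfPlane.denom_cocycle (realize σ M) (realize σ N) (z σ).im_ne_zero
  rw [← map_mul, ← UpperHalfPlane.coe_smul_of_det_pos (realize_det_pos hN σ) (z σ)] at h1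
  have hden : ∀ (P : GL (Fin 2) F) (w : ℂ),
      (σ (P 1 0) : ℂ) * w + (σ (P 1 1) : ℂ) = UpperHalfPlane.denom (realize σ P) w :=
    fun P w => rfl
  rw [hden, hden, hden, moebius, h1, mul_zpow, Units.val_mul, Matrix.det_mul, map_mul,
    Real.mul_rpow (hM σ).le (hN σ).le]
  push_cast
  ring

lemma slash_mul (k : (F →+* ℝ) → ℤ) (φ : HilbertHalfSpace F → ℂ) {M N : GL (Fin 2) F}
    (hM : TotallyPositive M.1.det) (hN : TotallyPositive N.1.det) :
    slash k φ (M * N) = slash k (slash k φ M) N := by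
  funext z
  simp only [slash, autFactor_mul k hM hN, moebius_mul, mul_assoc]

/-- `φ` is invariant under the weight `𝐤` action of `Γ_∞`. -/
def IsInvariant (k : (F →+* ℝ) → ℤ) (c : FractionalIdeal (𝓞 F)⁰ F)
    (φ : HilbertHalfSpace F → ℂ) : Prop :=
  ∀ M ∈ GammaInfty c, slash k φ M = φ

/-- The coset space `Γ_∞ \ Γ`, where `Γ = Γ₀(𝔠, 𝔫)`. -/
abbrev Cosets (c : FractionalIdeal (𝓞 F)⁰ F) (n : Ideal (𝓞 F)) : Type _ :=
  Quotient (QuotientGroup.rightRel ((GammaInfty c).subgroupOf (Gamma0 c n)))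

/-- The term `φ |_𝐤 M` of the Poincaré series, as a function of the coset `Γ_∞ M`. -/
def poincareTerm (k : (F →+* ℝ) → ℤ) (c : FractionalIdeal (𝓞 F)⁰ F) (n : Ideal (𝓞 F))
    (φ : HilbertHalfSpace F → ℂ) (hφ : IsInvariant k c φ) :
    Cosets c n → HilbertHalfSpace F → ℂ :=
  Quotient.lift (fun M : Gamma0 c n => slash k φ (M : GL (Fin 2) F)) (by
    intro M N h
    have h' : (N * M⁻¹ : Gamma0 c n) ∈ (GammaInfty c).subgroupOf (Gamma0 c n) :=
      QuotientGroup.rightRel_apply.mp h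
    have hP : ((N * M⁻¹ : Gamma0 c n) : GL (Fin 2) F) ∈ GammaInfty c :=
      Subgroup.mem_subgroupOf.mp h'
    have hN : (N : GL (Fin 2) F) = ((N * M⁻¹ : Gamma0 c n) : GL (Fin 2) F) * M := by
      simp
    change slash k φ M = slash k φ N
    rw [hN, slash_mul k φ (N * M⁻¹).2.2.2.2.2.2 M.2.2.2.2.2.2, hφ _ hP])

/-- The Hilbert Poincaré series `ℙ_𝐤(φ; z) = ∑_{M ∈ Γ_∞ \ Γ} (φ |_𝐤 M)(z)`. -/
def poincareSeries (k : (F →+* ℝ) → ℤ) (c : FractionalIdeal (𝓞 F)⁰ F) (n : Ideal (𝓞 F))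
    (φ : HilbertHalfSpace F → ℂ) (hφ : IsInvariant k c φ) (z : HilbertHalfSpace F) : ℂ :=
  ∑' M : Cosets c n, poincareTerm k c n φ hφ M z

/-- The set `𝔠⁺` of totally positive elements of `𝔠`. -/
def posPart (c : FractionalIdeal (𝓞 F)⁰ F) : Set F := {x | x ∈ c ∧ TotallyPositive x}

/-- `e(νz) = exp(2πi ∑_σ σ(ν) z_σ)`. -/
def expTrace (ν : F) (z : HilbertHalfSpace F) : ℂ :=
  Complex.exp (2 * Real.pi * Complex.I * ∑ σ : F →+* ℝ, (σ ν : ℂ) * (z σ : ℂ))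

/-- `φ(z) = ∑_{ν ∈ 𝔠⁺ ∪ {0}} a_ν e(νz)` on `ℍ^d`, as an (absolutely) convergent series. -/
def HasFourierExpansion (c : FractionalIdeal (𝓞 F)⁰ F) (φ : HilbertHalfSpace F → ℂ)
    (a : F → ℂ) : Prop :=
  ∀ z : HilbertHalfSpace F, HasSum
    (fun ν : (posPart c ∪ {0} : Set F) => a (ν : F) * expTrace (ν : F) z) (φ z)

/-- `a_ν = O(N(ν)^{𝐤/2 - 2 - ε})` for `ν ∈ 𝔠⁺`, where
`N(ν)^{𝐤/2 - 2 - ε} = ∏_σ σ(ν)^{k_σ/2 - 2 - ε}`. -/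
def HasGrowth (k : (F →+* ℝ) → ℤ) (c : FractionalIdeal (𝓞 F)⁰ F) (a : F → ℂ) (ε : ℝ) : Prop :=
  ∃ C : ℝ, ∀ ν ∈ posPart c, ‖a ν‖ ≤ C * ∏ σ : F →+* ℝ, (σ ν) ^ ((k σ : ℝ) / 2 - 2 - ε)

end HilbertPoincare

end

/-! The function `invNorm k φ`, that is |φ(z)| ∏ y_σ^(k_σ/2), turns the slash action into
substitution: its value for φ|M at z is its value for φ at Mz. With Y = ∏ y_σ, it is therefore
enough to bound it by C(Y^s₁ + Y^s₂) with s₁, s₂ > 1 (`exists_invNorm_le`). The Poincaré series is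
then dominated by Eisenstein series ∑ Y(Mz)^s with s > 1, and these converge because Γ_∞M is
determined by the bottom row of M up to units (`mul_inv_mem_GammaInfty`, `summable_prod_add_rpow`).

For the bound, Γ_∞ contains diag(u², 1) for every unit u, so z may be taken balanced: all y_σ
comparable to Y^(1/d). There one estimates the Fourier series term by term. Part of the exponential
decay lowers each power (ν_σ y_σ)^(k_σ/2) to (ν_σ y_σ)^(1+δ), giving N(ν)^(-(1+ε-δ)) Y^(1+δ); what
is left of it gives (Y^(1/d) Tr ν)^(-η). The trace factor is indispensable: N(ν)^(-α) alone is
constant along the infinite orbits of totally positive units, but Tr grows exponentially along them,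
so ∑ N(ν)^(-α) Tr(ν)^(-η) converges for α > 1, η > 0 (`summable_prod_rpow_mul_absTrace_rpow`). The
constant term contributes a power of Y with exponent the mean of the k_σ/2, which also exceeds 1. -/

namespace HilbertPoincare

open NumberField Module

/-! ### Sums over lattices with polynomial or exponential decay -/

section Lattice

/-- The p-th power of the inequality t ≤ exp t at t = cx/p. -/
lemma rpow_le_mul_exp {p c : ℝ} (hp : 0 < p) (hc : 0 < c) {x : ℝ} (hx : 0 ≤ x) :
    x ^ p ≤ (p / c) ^ p * Real.exp (c * x) := by
  have h1 : x ≤ p / c * Real.exp (c * x / p) := by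
    have h2 := Real.add_one_le_exp (c * x / p)
    calc x = p / c * (c * x / p) := by field_simp
      _ ≤ _ := by gcongr; linarith
  calc x ^ p ≤ (p / c * Real.exp (c * x / p)) ^ p := by gcongr
    _ = _ := by
      rw [Real.mul_rpow (by positivity) (by positivity), ← Real.exp_mul]
      congr 2
      field_simp

variable {E : Type*} [NormedAddCommGroup E] [NormedSpace ℝ E] [FiniteDimensional ℝ E]

lemma summable_one_add_norm_rpow (L : Submodule ℤ E) [DiscreteTopology L] {p : ℝ}
    (hp : (Module.finrank ℤ L : ℝ) < p) : Summable fun z : L => (1 + ‖z‖) ^ (-p) := by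
  have hp0 : 0 < p := lt_of_le_of_lt (by positivity) hp
  refine Summable.of_norm_bounded_eventually
    (ZLattice.summable_norm_rpow L (-p) (by linarith)) ?_
  -- The comparison with ‖z‖^(-p) fails only at z = 0, where the real power `0 ^ (-p)` is 0.
  have : ∀ᶠ z : L in Filter.cofinite, z ≠ 0 := by
    simp [Filter.eventually_cofinite]
  filter_upwards [this] with z hz
  have hz' : 0 < ‖z‖ := norm_pos_iff.mpr hz
  rw [Real.norm_of_nonneg (by positivity)]
  exact Real.rpow_le_rpow_of_nonpos hz' (by linarith) (by linarith)

lemma summable_exp_neg_norm (L : Submodule ℤ E) [DiscreteTopology L] {c : ℝ} (hc : 0 < c) :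
    Summable fun z : L => Real.exp (-(c * ‖z‖)) := by
  have hp : (Module.finrank ℤ L : ℝ) < Module.finrank ℤ L + 1 := by linarith
  have hp0 : (0 : ℝ) < Module.finrank ℤ L + 1 := by positivity
  generalize (Module.finrank ℤ L + 1 : ℝ) = p at hp hp0
  refine Summable.of_nonneg_of_le (fun z => (Real.exp_pos _).le) (fun z => ?_)
    ((summable_one_add_norm_rpow L hp).mul_left ((p / c) ^ p * Real.exp c))
  have h := rpow_le_mul_exp hp0 hc (x := 1 + ‖z‖) (by positivity)
  have h1 : 0 < (1 + ‖z‖) ^ p := by positivity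
  rw [Real.rpow_neg (by positivity), ← div_eq_mul_inv, le_div_iff₀ h1, Real.exp_neg,
    inv_mul_le_iff₀ (Real.exp_pos _)]
  calc _ ≤ _ := h
    _ = _ := by rw [mul_add, Real.exp_add]; ring_nf

end Lattice

/-! ### Embeddings, ideals and units of a totally real field -/

variable {F : Type*} [Field F] [NumberField F]

/-- `∑_σ |σ(x)|`, the trace of the absolute values of the conjugates. -/
noncomputable def absTrace (x : F) : ℝ := ∑ σ : F →+* ℝ, |σ x|

lemma abs_le_absTrace (x : F) (σ : F →+* ℝ) : |σ x| ≤ absTrace x :=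
  Finset.single_le_sum (f := fun σ : F →+* ℝ => |σ x|) (fun _ _ => abs_nonneg _)
    (Finset.mem_univ σ)

lemma absTrace_nonneg (x : F) : 0 ≤ absTrace x := Finset.sum_nonneg fun _ _ => abs_nonneg _

lemma prod_abs_pos {x : F} (hx : x ≠ 0) : 0 < ∏ σ : F →+* ℝ, |σ x| :=
  Finset.prod_pos fun σ _ => abs_pos.mpr ((map_ne_zero σ).mpr hx)

section TotallyReal

variable [IsTotallyReal F]

variable (F) in
/-- Real embeddings of a totally real field correspond to its infinite places. -/
noncomputable def placeEquiv : (F →+* ℝ) ≃ InfinitePlace F :=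
  Equiv.ofBijective (fun σ => InfinitePlace.mk (Complex.ofRealHom.comp σ)) (by
    constructor
    · intro σ τ h
      have h' := InfinitePlace.mk_eq_iff.mp h
      ext x
      apply Complex.ofReal_injective
      rcases h' with h' | h'
      · exact RingHom.congr_fun h' x
      · have := RingHom.congr_fun h' x
        simpa [ComplexEmbedding.conjugate] using this
    · intro w
      have hw := IsTotallyReal.isReal w
      refine ⟨InfinitePlace.embedding_of_isReal hw, ?_⟩
      apply InfinitePlace.ext
      intro x
      rw [InfinitePlace.apply, RingHom.comp_apply, Complex.ofRealHom_eq_coe,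
        InfinitePlace.embedding_of_isReal_apply, InfinitePlace.norm_embedding_eq])

lemma placeEquiv_apply (σ : F →+* ℝ) (x : F) : placeEquiv F σ x = |σ x| := by
  change InfinitePlace.mk (Complex.ofRealHom.comp σ) x = _
  rw [InfinitePlace.apply, RingHom.comp_apply, Complex.ofRealHom_eq_coe, Complex.norm_real,
    Real.norm_eq_abs]

lemma card_embeddings : Fintype.card (F →+* ℝ) = Module.finrank ℚ F := by
  rw [Fintype.card_congr (placeEquiv F), InfinitePlace.card_eq_nrRealPlaces_add_nrComplexPlaces,
    IsTotallyReal.nrComplexPlaces_eq_zero, ← IsTotallyReal.finrank, add_zero]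

lemma card_embeddings_pos : 0 < Fintype.card (F →+* ℝ) := by
  rw [card_embeddings]; exact Module.finrank_pos

instance : Nonempty (F →+* ℝ) := Fintype.card_pos_iff.mp card_embeddings_pos

lemma prod_abs_eq_norm (x : F) : ∏ σ : F →+* ℝ, |σ x| = |Algebra.norm ℚ x| := by
  rw [← InfinitePlace.prod_eq_abs_norm, ← Equiv.prod_comp (placeEquiv F)]
  refine Finset.prod_congr rfl fun σ _ => ?_
  rw [IsTotallyReal.mult_eq, pow_one, placeEquiv_apply]

lemma prod_abs_unit (u : (𝓞 F)ˣ) : ∏ σ : F →+* ℝ, |σ (u : F)| = 1 := by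
  rw [prod_abs_eq_norm, Units.norm]
  simp

lemma one_le_prod_abs_of_integral {x : 𝓞 F} (hx : x ≠ 0) : 1 ≤ ∏ σ : F →+* ℝ, |σ (x : F)| := by
  rw [prod_abs_eq_norm]
  have : Algebra.norm ℤ x ≠ 0 := Algebra.norm_ne_zero_iff.mpr hx
  have h := Int.one_le_abs this
  rw [← Algebra.coe_norm_int]
  rw [← Int.cast_one]
  exact_mod_cast h

/-- A common denominator m moves I into 𝒪, where nonzero elements have norm at least 1 in absolute
value. -/
lemma exists_le_prod_abs (I : FractionalIdeal (𝓞 F)⁰ F) :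
    ∃ r > 0, ∀ x ∈ I, x ≠ 0 → r ≤ ∏ σ : F →+* ℝ, |σ x| := by
  obtain ⟨m, hm, h⟩ := I.isFractional
  have hm0 : m ≠ 0 := nonZeroDivisors.ne_zero hm
  have hmF : (m : F) ≠ 0 := by simpa using hm0
  have hpos := prod_abs_pos hmF
  refine ⟨(∏ σ : F →+* ℝ, |σ (m : F)|)⁻¹, inv_pos.mpr hpos, fun x hx hx0 => ?_⟩
  obtain ⟨y, hy⟩ := h x hx
  rw [Algebra.smul_def] at hy
  have hy0 : y ≠ 0 := by
    rintro rfl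
    rw [map_zero] at hy
    exact mul_ne_zero hmF hx0 hy.symm
  have h1 := one_le_prod_abs_of_integral hy0
  have h2 : ∏ σ : F →+* ℝ, |σ (y : F)| =
      (∏ σ : F →+* ℝ, |σ (m : F)|) * ∏ σ : F →+* ℝ, |σ x| := by
    rw [← Finset.prod_mul_distrib]
    refine Finset.prod_congr rfl fun σ _ => ?_
    rw [← abs_mul, ← map_mul]
    congr 2
  rw [h2] at h1
  rwa [inv_le_iff_one_le_mul₀' hpos]

open scoped Classical in
lemma norm_mixedEmbedding_le (x : F) : ‖mixedEmbedding F x‖ ≤ absTrace x := by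
  rw [mixedEmbedding.norm_eq_sup'_normAtPlace]
  refine Finset.sup'_le _ _ fun w _ => ?_
  rw [mixedEmbedding.normAtPlace_apply, ← (placeEquiv F).apply_symm_apply w, placeEquiv_apply]
  exact abs_le_absTrace _ _

open scoped Classical in
-- I embeds as a lattice of rank d in the mixed space, and `absTrace` dominates the norm there.
lemma summable_one_add_absTrace {I : FractionalIdeal (𝓞 F)⁰ F} (hI : I ≠ 0) {p : ℝ}
    (hp : (Fintype.card (F →+* ℝ) : ℝ) < p) :
    Summable fun x : {x : F // x ∈ I} => (1 + absTrace (x : F)) ^ (-p) := by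
  have hp0 : 0 < p := lt_of_le_of_lt (by positivity) hp
  let L := mixedEmbedding.idealLattice F (Units.mk0 I hI)
  have hr : Module.finrank ℤ L = Fintype.card (F →+* ℝ) := by
    rw [ZLattice.rank ℝ L, mixedEmbedding.finrank, card_embeddings]
  have hs := summable_one_add_norm_rpow L (p := p) (by rw [hr]; exact hp)
  let g : {x : F // x ∈ I} → L := fun x =>
    ⟨mixedEmbedding F x, (mixedEmbedding.mem_idealLattice F _).mpr ⟨x, x.2, rfl⟩⟩
  have hg : Function.Injective g := fun x y h =>
    Subtype.ext (mixedEmbedding_injective F (congrArg Subtype.val h))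
  refine Summable.of_nonneg_of_le (fun x => ?_) (fun x => ?_) (hs.comp_injective hg)
  · have := absTrace_nonneg (x : F)
    positivity
  · exact Real.rpow_le_rpow_of_nonpos (by positivity)
      (add_le_add_right (norm_mixedEmbedding_le (x : F)) 1) (by linarith)

variable (F) in
-- Dirichlet's unit theorem in geometric form: scale x to norm 1 and move it by a unit into the
-- fundamental cone, whose part of norm at most 1 is bounded.
lemma exists_unit_balanced : ∃ B : ℝ, 1 ≤ B ∧ ∀ x : (F →+* ℝ) → ℝ, (∀ σ, 0 < x σ) →
    ∃ u : (𝓞 F)ˣ, ∀ σ, |σ (u : F)| * x σ ≤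
      B * (∏ τ, x τ) ^ (1 / (Fintype.card (F →+* ℝ) : ℝ)) := by
  classical
  obtain ⟨B, hB⟩ := isBounded_iff_forall_norm_le.mp
    (mixedEmbedding.fundamentalCone.isBounded_normLeOne F)
  refine ⟨max B 1, le_max_right _ _, fun x hx => ?_⟩
  have hP : 0 < ∏ τ, x τ := Finset.prod_pos fun τ _ => hx τ
  have hd : (Fintype.card (F →+* ℝ) : ℝ) ≠ 0 := by exact_mod_cast card_embeddings_pos.ne'
  set t := (∏ τ, x τ) ^ (1 / (Fintype.card (F →+* ℝ) : ℝ)) with ht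
  have ht0 : 0 < t := by positivity
  have htd : t ^ Fintype.card (F →+* ℝ) = ∏ τ, x τ := by
    rw [ht, ← Real.rpow_natCast, ← Real.rpow_mul hP.le, one_div_mul_cancel hd, Real.rpow_one]
  let y : mixedEmbedding.mixedSpace F :=
    (fun w => t⁻¹ * x ((placeEquiv F).symm w), fun _ => 0)
  have hy : ∀ σ, mixedEmbedding.normAtPlace (placeEquiv F σ) y = t⁻¹ * x σ := by
    intro σ
    rw [mixedEmbedding.normAtPlace_apply_of_isReal (IsTotallyReal.isReal _)]
    simp only [y, Equiv.symm_apply_apply]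
    rw [Real.norm_of_nonneg]
    exact mul_nonneg (inv_nonneg.mpr ht0.le) (hx σ).le
  have hy1 : mixedEmbedding.norm y = 1 := by
    rw [mixedEmbedding.norm_apply, ← Equiv.prod_comp (placeEquiv F)]
    simp_rw [hy, IsTotallyReal.mult_eq, pow_one]
    rw [Finset.prod_mul_distrib, Finset.prod_const, Finset.card_univ, inv_pow, htd,
      inv_mul_cancel₀ hP.ne']
  obtain ⟨u, hu⟩ := mixedEmbedding.fundamentalCone.exists_unit_smul_mem (x := y) (by simp [hy1])
  refine ⟨u, fun σ => ?_⟩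
  have h1 := hB (u • y) (mixedEmbedding.fundamentalCone.mem_normLeOne.mpr
    ⟨hu, by rw [mixedEmbedding.norm_unit_smul, hy1]⟩)
  have h2 : mixedEmbedding.normAtPlace (placeEquiv F σ) (u • y) ≤ ‖u • y‖ := by
    rw [mixedEmbedding.norm_eq_sup'_normAtPlace]
    exact Finset.le_sup' (fun w => mixedEmbedding.normAtPlace w (u • y)) (Finset.mem_univ _)
  rw [mixedEmbedding.unitSMul_smul, map_mul, hy, mixedEmbedding.normAtPlace_apply,
    placeEquiv_apply] at h2
  have h3 := (h2.trans h1).trans (le_max_left B 1)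
  calc |σ (u : F)| * x σ = (|σ (u : F)| * (t⁻¹ * x σ)) * t := by field_simp
    _ ≤ _ := by gcongr

open scoped Classical in
-- The numbers log|σ(u)| sum to zero, so a common upper bound M for them also bounds them below by
-- -(d-1)M. With M = log of the trace, every coordinate of the log embedding is at most dM in
-- absolute value.
lemma exp_norm_logEmbedding_le (u : (𝓞 F)ˣ) :
    Real.exp (‖Units.logEmbedding F (Additive.ofMul u)‖ / Fintype.card (F →+* ℝ)) ≤
      absTrace (u : F) := by
  have hd : (0 : ℝ) < Fintype.card (F →+* ℝ) := by exact_mod_cast card_embeddings_pos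
  have hu : ∀ σ : F →+* ℝ, 0 < |σ (u : F)| := fun σ =>
    abs_pos.mpr ((map_ne_zero σ).mpr (by simp))
  obtain ⟨σ₀⟩ := (inferInstance : Nonempty (F →+* ℝ))
  have hT : 0 < absTrace (u : F) := (hu σ₀).trans_le (abs_le_absTrace _ _)
  set M := Real.log (absTrace (u : F)) with hM
  have h1 : ∀ σ : F →+* ℝ, Real.log |σ (u : F)| ≤ M := fun σ =>
    Real.log_le_log (hu σ) (abs_le_absTrace _ _)
  have h2 : ∑ σ : F →+* ℝ, Real.log |σ (u : F)| = 0 := by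
    rw [← Real.log_prod fun σ _ => (hu σ).ne', prod_abs_unit, Real.log_one]
  have hM0 : 0 ≤ M := by
    have : ∑ σ : F →+* ℝ, Real.log |σ (u : F)| ≤ ∑ _σ : F →+* ℝ, M :=
      Finset.sum_le_sum fun σ _ => h1 σ
    rw [h2, Finset.sum_const, Finset.card_univ, nsmul_eq_mul] at this
    exact nonneg_of_mul_nonneg_right this hd
  have h3 : ∀ σ : F →+* ℝ, |Real.log (|σ (u : F)|)| ≤ Fintype.card (F →+* ℝ) * M := by
    intro σ
    have h4 : M - Real.log |σ (u : F)| ≤ ∑ τ : F →+* ℝ, (M - Real.log |τ (u : F)|) :=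
      Finset.single_le_sum (f := fun τ : F →+* ℝ => M - Real.log |τ (u : F)|)
        (fun τ _ => sub_nonneg.mpr (h1 τ)) (Finset.mem_univ σ)
    rw [Finset.sum_sub_distrib, h2, Finset.sum_const, Finset.card_univ, nsmul_eq_mul] at h4
    have h5 : M ≤ Fintype.card (F →+* ℝ) * M :=
      le_mul_of_one_le_left hM0 (by exact_mod_cast card_embeddings_pos)
    rw [abs_le]
    constructor
    · linarith
    · linarith [h1 σ]
  have h6 : ‖Units.logEmbedding F (Additive.ofMul u)‖ ≤ Fintype.card (F →+* ℝ) * M := by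
    rw [pi_norm_le_iff_of_nonneg (by positivity)]
    intro w
    rw [Units.dirichletUnitTheorem.logEmbedding_component, IsTotallyReal.mult_eq, Nat.cast_one,
      one_mul, Real.norm_eq_abs, ← (placeEquiv F).apply_symm_apply w.1, placeEquiv_apply]
    exact h3 _
  rw [← Real.le_log_iff_exp_le hT, div_le_iff₀ hd, mul_comm]
  exact h6

/-- The logarithms determine all |σ(u)|, hence u up to sign; squaring removes the sign. -/
lemma sq_eq_sq_of_logEmbedding_eq {u v : (𝓞 F)ˣ}
    (h : Units.logEmbedding F (Additive.ofMul u) = Units.logEmbedding F (Additive.ofMul v)) :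
    (u : F) ^ 2 = (v : F) ^ 2 := by
  have h1 : Units.logEmbedding F (Additive.ofMul (u * v⁻¹)) = 0 := by
    rw [ofMul_mul, map_add, ofMul_inv, map_neg, h, add_neg_cancel]
  rw [Units.dirichletUnitTheorem.logEmbedding_eq_zero_iff, Units.mem_torsion] at h1
  obtain ⟨σ⟩ := (inferInstance : Nonempty (F →+* ℝ))
  have h2 := h1 (placeEquiv F σ)
  apply σ.injective
  rw [map_pow, map_pow, sq_eq_sq_iff_abs_eq_abs]
  rw [placeEquiv_apply, Units.coe_mul, map_mul, abs_mul] at h2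
  have h3 : |σ ((v⁻¹ : (𝓞 F)ˣ) : F)| * |σ (v : F)| = 1 := by
    rw [← abs_mul, ← map_mul, ← Units.coe_mul]
    simp
  calc |σ (u : F)| = |σ (u : F)| * (|σ ((v⁻¹ : (𝓞 F)ˣ) : F)| * |σ (v : F)|) := by
        rw [h3, mul_one]
    _ = _ := by rw [← mul_assoc, h2, one_mul]

end TotallyReal

/-! ### Real powers and geometric means -/

lemma rpow_neg_le_mul_rpow_neg {a K w m : ℝ} (ha : 0 < a) (hK : 0 < K) (hw : 0 < w) (hm : 0 ≤ m)
    (h : a ≤ K * w) : w ^ (-m) ≤ K ^ m * a ^ (-m) := by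
  have h1 : a ^ m ≤ K ^ m * w ^ m := by
    rw [← Real.mul_rpow hK.le hw.le]
    exact Real.rpow_le_rpow ha.le h hm
  have ham : 0 < a ^ m := by positivity
  have hwm : 0 < w ^ m := by positivity
  rw [Real.rpow_neg hw.le, Real.rpow_neg ha.le, ← div_eq_mul_inv, le_div_iff₀ ham,
    inv_mul_le_iff₀ hwm, mul_comm]
  exact h1

lemma rpow_one_div_pow {P : ℝ} (hP : 0 ≤ P) {d : ℕ} (hd : d ≠ 0) :
    (P ^ (1 / (d : ℝ))) ^ d = P := by
  rw [one_div]
  exact Real.rpow_inv_natCast_pow hP hd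

lemma rpow_eq_rpow_one_div_rpow {P : ℝ} (hP : 0 ≤ P) {d : ℕ} (hd : d ≠ 0) (s : ℝ) :
    P ^ s = (P ^ (1 / (d : ℝ))) ^ (d * s) := by
  have : (d : ℝ) ≠ 0 := by exact_mod_cast hd
  rw [← Real.rpow_mul hP]
  congr 1
  field_simp

/-- If the entries of a vector are at most a multiple of their geometric mean, they are also at
least a multiple of it. -/
lemma geom_mean_le_of_le_geom_mean {ι : Type*} [Fintype ι] {x : ι → ℝ} (hx : ∀ i, 0 < x i)
    {B t : ℝ} (ht : 0 < t) (htx : t ^ Fintype.card ι = ∏ i, x i)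
    (h : ∀ i, x i ≤ B * t) (i : ι) : t ≤ B ^ (Fintype.card ι - 1) * x i := by
  classical
  have h1 : ∏ j, x j ≤ x i * (B * t) ^ (Fintype.card ι - 1) := by
    rw [← Finset.mul_prod_erase Finset.univ x (Finset.mem_univ i)]
    refine mul_le_mul_of_nonneg_left ?_ (hx i).le
    calc ∏ j ∈ Finset.univ.erase i, x j ≤ ∏ _j ∈ Finset.univ.erase i, (B * t) :=
          Finset.prod_le_prod (fun j _ => (hx j).le) fun j _ => h j
      _ = _ := by
          rw [Finset.prod_const, Finset.card_erase_of_mem (Finset.mem_univ i), Finset.card_univ]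
  obtain ⟨m, hm⟩ : ∃ m, Fintype.card ι = m + 1 :=
    ⟨Fintype.card ι - 1, (Nat.sub_add_cancel (Fintype.card_pos_iff.mpr ⟨i⟩)).symm⟩
  rw [← htx, hm, Nat.add_sub_cancel, mul_pow, pow_succ] at h1
  rw [hm, Nat.add_sub_cancel]
  have htm : 0 < t ^ m := by positivity
  refine le_of_mul_le_mul_left ?_ htm
  linarith

lemma TotallyPositive.ne_zero [IsTotallyReal F] {x : F} (hx : TotallyPositive x) : x ≠ 0 := by
  rintro rfl
  obtain ⟨σ⟩ := (inferInstance : Nonempty (F →+* ℝ))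
  simpa using hx σ

lemma TotallyPositive.prod_abs {x : F} (hx : TotallyPositive x) :
    ∏ σ : F →+* ℝ, |σ x| = ∏ σ : F →+* ℝ, σ x :=
  Finset.prod_congr rfl fun σ _ => abs_of_pos (hx σ)

lemma unit_mul_mem {I : FractionalIdeal (𝓞 F)⁰ F} (u : (𝓞 F)ˣ) {x : F} (hx : x ∈ I) :
    (u : F) * x ∈ I :=
  int_mul_mem ⟨(u : 𝓞 F), rfl⟩ hx

/-! ### Convergence of sums controlled by balancing units -/

section TotallyReal

variable [IsTotallyReal F]

variable (F) in
-- Squares are needed because u² is totally positive, so that diag(u², 1) lies in Γ_∞. They come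
-- from balancing the vector of square roots. The lower bound follows from the upper one since
-- multiplying by u² preserves the product.
lemma exists_unit_sq_balanced : ∃ B : ℝ, 1 ≤ B ∧ ∀ x : (F →+* ℝ) → ℝ, (∀ σ, 0 < x σ) →
    ∃ u : (𝓞 F)ˣ, ∀ σ,
      σ (u : F) ^ 2 * x σ ≤ B * (∏ τ, x τ) ^ (1 / (Fintype.card (F →+* ℝ) : ℝ)) ∧
      (∏ τ, x τ) ^ (1 / (Fintype.card (F →+* ℝ) : ℝ)) ≤ B * (σ (u : F) ^ 2 * x σ) := by
  obtain ⟨B, hB1, hB⟩ := exists_unit_balanced F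
  have hB2 : 1 ≤ B ^ 2 := one_le_pow₀ hB1
  set d := Fintype.card (F →+* ℝ) with hd
  have hd0 : d ≠ 0 := card_embeddings_pos.ne'
  -- `B ^ 2` serves the upper bound and `(B ^ 2) ^ (d - 1)` the lower one; both are at least 1, so
  -- their product serves for both.
  refine ⟨B ^ 2 * (B ^ 2) ^ (d - 1), by nlinarith [one_le_pow₀ (n := d - 1) hB2],
    fun x hx => ?_⟩
  obtain ⟨u, hu⟩ := hB (fun σ => √(x σ)) (fun σ => Real.sqrt_pos.mpr (hx σ))
  have hP : 0 < ∏ τ, x τ := Finset.prod_pos fun τ _ => hx τ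
  have hu0 : ∀ σ : F →+* ℝ, 0 < σ (u : F) ^ 2 := fun σ =>
    sq_pos_of_ne_zero ((map_ne_zero σ).mpr (by simp))
  set t := (∏ τ, x τ) ^ (1 / (d : ℝ)) with ht
  have ht0 : 0 < t := by positivity
  have h1 : ((∏ τ, √(x τ)) ^ (1 / (d : ℝ))) ^ 2 = t := by
    rw [← Real.sqrt_prod _ fun τ _ => (hx τ).le, Real.sqrt_eq_rpow, ← Real.rpow_mul hP.le,
      ← Real.rpow_natCast, ← Real.rpow_mul hP.le, ht]
    congr 1
    push_cast
    ring
  have h2 : ∀ σ, σ (u : F) ^ 2 * x σ ≤ B ^ 2 * t := by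
    intro σ
    have := pow_le_pow_left₀ (by positivity) (hu σ) 2
    rwa [mul_pow, mul_pow, sq_abs, Real.sq_sqrt (hx σ).le, h1] at this
  have h3 : ∏ σ : F →+* ℝ, (σ (u : F) ^ 2 * x σ) = ∏ σ, x σ := by
    rw [Finset.prod_mul_distrib]
    have : ∏ σ : F →+* ℝ, σ (u : F) ^ 2 = 1 := by
      rw [Finset.prod_pow, ← sq_abs, Finset.abs_prod, prod_abs_unit, one_pow]
    rw [this, one_mul]
  refine ⟨u, fun σ => ⟨(h2 σ).trans ?_, ?_⟩⟩
  · gcongr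
    exact le_mul_of_one_le_right (by positivity) (one_le_pow₀ hB2)
  · have h4 := geom_mean_le_of_le_geom_mean (fun σ => mul_pos (hu0 σ) (hx σ)) (B := B ^ 2)
      ht0 (by rw [h3]; exact rpow_one_div_pow hP.le hd0) h2 σ
    refine h4.trans ?_
    have := mul_pos (hu0 σ) (hx σ)
    gcongr
    exact le_mul_of_one_le_left (by positivity) hB2

/-- Eisenstein series of weight `s > 1`: convergence of the sum over pairs modulo units. -/
lemma summable_prod_add_rpow {I J : FractionalIdeal (𝓞 F)⁰ F} (hI : I ≠ 0) (hJ : J ≠ 0)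
    {ι : Type*} (p q : ι → F) (hp : ∀ i, p i ∈ I) (hq : ∀ i, q i ∈ J)
    (h0 : ∀ i, p i ≠ 0 ∨ q i ≠ 0)
    (hinj : ∀ i j (u : (𝓞 F)ˣ), p i = u * p j → q i = u * q j → i = j) {s : ℝ} (hs : 1 < s) :
    Summable fun i => (∏ σ : F →+* ℝ, (|σ (p i)| + |σ (q i)|)) ^ (-(2 * s)) := by
  obtain ⟨B, hB1, hB⟩ := exists_unit_balanced F
  obtain ⟨r₁, hr₁, hI'⟩ := exists_le_prod_abs I
  obtain ⟨r₂, hr₂, hJ'⟩ := exists_le_prod_abs J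
  set d := Fintype.card (F →+* ℝ) with hd
  have hd0 : d ≠ 0 := card_embeddings_pos.ne'
  have hdR : (0 : ℝ) < d := by exact_mod_cast card_embeddings_pos
  have hv : ∀ i (σ : F →+* ℝ), 0 < |σ (p i)| + |σ (q i)| := by
    intro i σ
    rcases h0 i with h | h
    · have := abs_pos.mpr ((map_ne_zero σ).mpr h)
      positivity
    · have := abs_pos.mpr ((map_ne_zero σ).mpr h)
      positivity
  have hex : ∀ i, ∃ u : (𝓞 F)ˣ, ∀ σ : F →+* ℝ, |σ (u : F)| * (|σ (p i)| + |σ (q i)|) ≤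
      B * (∏ σ : F →+* ℝ, (|σ (p i)| + |σ (q i)|)) ^ (1 / (d : ℝ)) := fun i => hB _ (hv i)
  choose u hu using hex
  -- Scaling each pair by its balancing unit selects one lattice point of I × J per class modulo
  -- units.
  let g : ι → {x : F // x ∈ I} × {x : F // x ∈ J} := fun i =>
    (⟨u i * p i, unit_mul_mem _ (hp i)⟩, ⟨u i * q i, unit_mul_mem _ (hq i)⟩)
  have hg : Function.Injective g := by
    intro i j hij
    have e1 : (u i : F) * p i = u j * p j := congrArg (fun x => (x.1 : F)) hij
    have e2 : (u i : F) * q i = u j * q j := congrArg (fun x => (x.2 : F)) hij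
    have hui : (u i : F) ≠ 0 := by simp
    have hc : (((u i)⁻¹ * u j : (𝓞 F)ˣ) : F) = (u i : F)⁻¹ * u j := by
      rw [eq_inv_mul_iff_mul_eq₀ hui, ← Units.coe_mul, mul_inv_cancel_left]
    refine hinj i j ((u i)⁻¹ * u j) ?_ ?_
    · rw [hc, mul_assoc, ← e1, inv_mul_cancel_left₀ hui]
    · rw [hc, mul_assoc, ← e2, inv_mul_cancel_left₀ hui]
  have hds : (Fintype.card (F →+* ℝ) : ℝ) < d * s := by
    rw [← hd]; exact lt_mul_of_one_lt_right hdR hs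
  have hsum := ((summable_one_add_absTrace hI hds).mul_of_nonneg (summable_one_add_absTrace hJ hds)
    (fun x => Real.rpow_nonneg (by linarith [absTrace_nonneg (x : F)]) _)
    (fun x => Real.rpow_nonneg (by linarith [absTrace_nonneg (x : F)]) _)).comp_injective hg
  have hr : 0 < min r₁ r₂ := lt_min hr₁ hr₂
  set r := min r₁ r₂ with hrdef
  -- With w the d-th root of the product, the first summand of K absorbs 1 (as w ≥ r^(1/d)) and the
  -- second absorbs the traces, so 1 + Tr ≤ K w.
  set K := (r ^ (1 / (d : ℝ)))⁻¹ + d * B with hK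
  have hK0 : 0 < K := by positivity
  refine Summable.of_nonneg_of_le (fun i => ?_) (fun i => ?_)
    (hsum.mul_left (K ^ (d * s) * K ^ (d * s)))
  · exact Real.rpow_nonneg (Finset.prod_nonneg fun σ _ => (hv i σ).le) _
  have hP : 0 < ∏ σ : F →+* ℝ, (|σ (p i)| + |σ (q i)|) := Finset.prod_pos fun σ _ => hv i σ
  have hPr : r ≤ ∏ σ : F →+* ℝ, (|σ (p i)| + |σ (q i)|) := by
    rcases h0 i with h | h
    · refine (min_le_left _ _).trans ((hI' _ (hp i) h).trans ?_)
      exact Finset.prod_le_prod (fun _ _ => abs_nonneg _)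
        fun σ _ => le_add_of_nonneg_right (abs_nonneg _)
    · refine (min_le_right _ _).trans ((hJ' _ (hq i) h).trans ?_)
      exact Finset.prod_le_prod (fun _ _ => abs_nonneg _)
        fun σ _ => le_add_of_nonneg_left (abs_nonneg _)
  have hT : absTrace ((u i : F) * p i) + absTrace ((u i : F) * q i) ≤
      d * (B * (∏ σ : F →+* ℝ, (|σ (p i)| + |σ (q i)|)) ^ (1 / (d : ℝ))) := by
    rw [absTrace, absTrace, ← Finset.sum_add_distrib]
    calc _ ≤ ∑ _σ : F →+* ℝ,
          (B * (∏ σ : F →+* ℝ, (|σ (p i)| + |σ (q i)|)) ^ (1 / (d : ℝ))) := by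
          refine Finset.sum_le_sum fun σ _ => ?_
          rw [map_mul, map_mul, abs_mul, abs_mul, ← mul_add]
          exact hu i σ
      _ = _ := by rw [Finset.sum_const, Finset.card_univ, nsmul_eq_mul]
  rw [rpow_eq_rpow_one_div_rpow hP.le hd0]
  have hw1 : 1 ≤ (r ^ (1 / (d : ℝ)))⁻¹ *
      (∏ σ : F →+* ℝ, (|σ (p i)| + |σ (q i)|)) ^ (1 / (d : ℝ)) := by
    rw [one_le_inv_mul₀ (by positivity)]
    exact Real.rpow_le_rpow hr.le hPr (by positivity)
  have hw0 : 0 < (∏ σ : F →+* ℝ, (|σ (p i)| + |σ (q i)|)) ^ (1 / (d : ℝ)) := by positivity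
  generalize (∏ σ : F →+* ℝ, (|σ (p i)| + |σ (q i)|)) ^ (1 / (d : ℝ)) = w at hw0 hw1 hT ⊢
  have n1 := absTrace_nonneg ((u i : F) * p i)
  have n2 := absTrace_nonneg ((u i : F) * q i)
  have b1 := rpow_neg_le_mul_rpow_neg (a := 1 + absTrace ((u i : F) * p i)) (K := K) (w := w)
    (m := d * s) (by positivity) hK0 hw0 (by positivity) (by rw [hK, add_mul]; linarith)
  have b2 := rpow_neg_le_mul_rpow_neg (a := 1 + absTrace ((u i : F) * q i)) (K := K) (w := w)
    (m := d * s) (by positivity) hK0 hw0 (by positivity) (by rw [hK, add_mul]; linarith)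
  -- The exponent is shared equally: each of the two lattices receives d·s, which exceeds its rank
  -- d.
  calc w ^ (d * -(2 * s)) = w ^ (-(d * s)) * w ^ (-(d * s)) := by
        rw [← Real.rpow_add hw0]; congr 1; ring
    _ ≤ _ := mul_le_mul b1 b2 (by positivity) (by positivity)
    _ = _ := by simp only [g, Function.comp]; ring

/-- Write ν = u⁻²(u²ν) with u²ν balanced. The norm factor sums the balanced elements over the
lattice 𝔠, and the trace factor decays exponentially in the logarithm of u, which sums over the unit
lattice. -/
lemma summable_prod_rpow_mul_absTrace_rpow {c : FractionalIdeal (𝓞 F)⁰ F} (hc : c ≠ 0)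
    {α η : ℝ} (hα : 1 < α) (hη : 0 < η) :
    Summable fun ν : posPart c =>
      (∏ σ : F →+* ℝ, σ (ν : F)) ^ (-α) * absTrace (ν : F) ^ (-η) := by
  classical
  obtain ⟨B, hB1, hB⟩ := exists_unit_sq_balanced F
  obtain ⟨r, hr, hI'⟩ := exists_le_prod_abs c
  set d := Fintype.card (F →+* ℝ) with hd
  have hd0 : d ≠ 0 := card_embeddings_pos.ne'
  have hdR : (0 : ℝ) < d := by exact_mod_cast card_embeddings_pos
  have hex : ∀ ν : posPart c, ∃ u : (𝓞 F)ˣ, ∀ σ : F →+* ℝ,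
      σ (u : F) ^ 2 * σ (ν : F) ≤ B * (∏ τ : F →+* ℝ, τ (ν : F)) ^ (1 / (d : ℝ)) ∧
      (∏ τ : F →+* ℝ, τ (ν : F)) ^ (1 / (d : ℝ)) ≤ B * (σ (u : F) ^ 2 * σ (ν : F)) :=
    fun ν => hB (fun σ => σ (ν : F)) ν.2.2
  choose u hu using hex
  let g : posPart c → {x : F // x ∈ c} × Units.unitLattice F := fun ν =>
    (⟨u ν * (u ν * ν), unit_mul_mem _ (unit_mul_mem _ ν.2.1)⟩,
      ⟨Units.logEmbedding F (Additive.ofMul (u ν)), ⟨Additive.ofMul (u ν), trivial, rfl⟩⟩)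
  have hg : Function.Injective g := by
    intro ν μ h
    have e1 : (u ν : F) * (u ν * ν) = u μ * (u μ * μ) := congrArg (fun x => (x.1 : F)) h
    have e2 : Units.logEmbedding F (Additive.ofMul (u ν)) =
      Units.logEmbedding F (Additive.ofMul (u μ)) := congrArg (fun x => x.2.1) h
    have e3 := sq_eq_sq_of_logEmbedding_eq e2
    rw [← mul_assoc, ← mul_assoc, ← sq, ← sq, e3] at e1
    exact Subtype.ext (mul_left_cancel₀ (pow_ne_zero 2 (by simp)) e1)
  have hds : (Fintype.card (F →+* ℝ) : ℝ) < d * α := by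
    rw [← hd]; exact lt_mul_of_one_lt_right hdR hα
  have hsum := ((summable_one_add_absTrace hc hds).mul_of_nonneg
    (summable_exp_neg_norm (Units.unitLattice F) (div_pos hη hdR))
    (fun x => Real.rpow_nonneg (by linarith [absTrace_nonneg (x : F)]) _)
    (fun x => (Real.exp_pos _).le)).comp_injective hg
  set K := (r ^ (1 / (d : ℝ)))⁻¹ + d * B with hK
  have hK0 : 0 < K := by positivity
  set L := (r ^ (1 / (d : ℝ)))⁻¹ * B with hL
  have hL0 : 0 < L := by positivity
  refine Summable.of_nonneg_of_le (fun ν => ?_) (fun ν => ?_)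
    (hsum.mul_left (K ^ (d * α) * L ^ η))
  · exact mul_nonneg (Real.rpow_nonneg (Finset.prod_nonneg fun σ _ => (ν.2.2 σ).le) _)
      (Real.rpow_nonneg (absTrace_nonneg _) _)
  have hP : 0 < ∏ σ : F →+* ℝ, σ (ν : F) := Finset.prod_pos fun σ _ => ν.2.2 σ
  have hPr : r ≤ ∏ σ : F →+* ℝ, σ (ν : F) := by
    rw [← ν.2.2.prod_abs]
    exact hI' _ ν.2.1 ν.2.2.ne_zero
  have huν := hu ν
  have hT : absTrace ((u ν : F) * (u ν * ν)) ≤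
      d * (B * (∏ σ : F →+* ℝ, σ (ν : F)) ^ (1 / (d : ℝ))) := by
    rw [absTrace]
    calc _ ≤ ∑ _σ : F →+* ℝ, (B * (∏ σ : F →+* ℝ, σ (ν : F)) ^ (1 / (d : ℝ))) := by
          refine Finset.sum_le_sum fun σ _ => ?_
          rw [map_mul, map_mul, ← mul_assoc, ← sq, abs_of_nonneg
            (mul_nonneg (sq_nonneg _) (ν.2.2 σ).le)]
          exact (huν σ).1
      _ = _ := by rw [Finset.sum_const, Finset.card_univ, nsmul_eq_mul]
  rw [rpow_eq_rpow_one_div_rpow hP.le hd0]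
  have hrw : r ^ (1 / (d : ℝ)) ≤ (∏ σ : F →+* ℝ, σ (ν : F)) ^ (1 / (d : ℝ)) :=
    Real.rpow_le_rpow hr.le hPr (by positivity)
  have hw1 : 1 ≤ (r ^ (1 / (d : ℝ)))⁻¹ * (∏ σ : F →+* ℝ, σ (ν : F)) ^ (1 / (d : ℝ)) := by
    rwa [one_le_inv_mul₀ (by positivity)]
  have hw0 : 0 < (∏ σ : F →+* ℝ, σ (ν : F)) ^ (1 / (d : ℝ)) := by positivity
  generalize (∏ σ : F →+* ℝ, σ (ν : F)) ^ (1 / (d : ℝ)) = w at hw0 hw1 hT huν hrw ⊢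
  have n1 := absTrace_nonneg ((u ν : F) * (u ν * ν))
  have b1 := rpow_neg_le_mul_rpow_neg (a := 1 + absTrace ((u ν : F) * (u ν * ν))) (K := K)
    (w := w) (m := d * α) (by positivity) hK0 hw0 (by positivity) (by rw [hK, add_mul]; linarith)
  -- The log embedding of u⁻² has twice the norm of that of u; the factor 2 is not needed and is
  -- dropped next.
  have hexp := exp_norm_logEmbedding_le ((u ν)⁻¹ ^ 2)
  rw [ofMul_pow, ofMul_inv, map_nsmul, map_neg, smul_neg, norm_neg, ← hd] at hexp
  have hexp2 : Real.exp (‖Units.logEmbedding F (Additive.ofMul (u ν))‖ / d) ≤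
      absTrace (((u ν)⁻¹ ^ 2 : (𝓞 F)ˣ) : F) := by
    refine le_trans ?_ hexp
    gcongr
    rw [two_nsmul, ← two_smul ℝ, norm_smul]
    have := norm_nonneg (Units.logEmbedding F (Additive.ofMul (u ν)))
    norm_num
    linarith
  -- Since u²ν is balanced and its norm is at least r, each σ(u²ν) is bounded below, so σ(u⁻²) is at
  -- most a multiple of σ(ν).
  have hT2 : absTrace (((u ν)⁻¹ ^ 2 : (𝓞 F)ˣ) : F) ≤ L * absTrace (ν : F) := by
    rw [absTrace, absTrace, Finset.mul_sum]
    refine Finset.sum_le_sum fun σ _ => ?_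
    have hσ : 0 < σ (u ν : F) ^ 2 := by
      have : σ (u ν : F) ≠ 0 := (map_ne_zero σ).mpr (by simp)
      positivity
    have hinv : (((u ν)⁻¹ ^ 2 : (𝓞 F)ˣ) : F) = ((u ν : F) ^ 2)⁻¹ := by
      apply eq_inv_of_mul_eq_one_left
      rw [← Units.coe_pow, ← Units.coe_mul, ← mul_pow, inv_mul_cancel]
      simp
    rw [hinv, map_inv₀, map_pow, abs_of_pos (inv_pos.mpr hσ), abs_of_pos (ν.2.2 σ),
      inv_le_iff_one_le_mul₀ hσ, hL]
    have h5 := hrw.trans (huν σ).2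
    calc (1 : ℝ) = (r ^ (1 / (d : ℝ)))⁻¹ * r ^ (1 / (d : ℝ)) := by
          rw [inv_mul_cancel₀ (by positivity)]
      _ ≤ (r ^ (1 / (d : ℝ)))⁻¹ * (B * (σ (u ν : F) ^ 2 * σ (ν : F))) := by gcongr
      _ = _ := by ring
  have hTpos : 0 < absTrace (ν : F) := by
    have := (Real.exp_pos _).trans_le (hexp2.trans hT2)
    exact pos_of_mul_pos_right this hL0.le
  have b2 := rpow_neg_le_mul_rpow_neg (Real.exp_pos _) hL0 hTpos hη.le (hexp2.trans hT2)
  calc w ^ (d * -α) * absTrace (ν : F) ^ (-η)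
      = w ^ (-(d * α)) * absTrace (ν : F) ^ (-η) := by rw [mul_neg]
    _ ≤ _ := mul_le_mul b1 b2 (by positivity) (by positivity)
    _ = _ := by
      rw [← Real.exp_mul]
      simp only [g, Function.comp, Submodule.coe_norm]
      rw [show -(η / d * ‖Units.logEmbedding F (Additive.ofMul (u ν))‖) =
        ‖Units.logEmbedding F (Additive.ofMul (u ν))‖ / d * -η by ring]
      ring

end TotallyReal

/-! ### The invariant norm and elementary exponential bounds -/

/-- `|φ(z)| ∏_σ y_σ^{k_σ/2}`. -/
noncomputable def invNorm (k : (F →+* ℝ) → ℤ) (φ : HilbertHalfSpace F → ℂ)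
    (z : HilbertHalfSpace F) : ℝ :=
  ‖φ z‖ * ∏ σ, (z σ).im ^ ((k σ : ℝ) / 2)

/-- `∏_σ y_σ`. -/
noncomputable def imProd (z : HilbertHalfSpace F) : ℝ := ∏ σ, (z σ).im

lemma imProd_pos (z : HilbertHalfSpace F) : 0 < imProd z :=
  Finset.prod_pos fun σ _ => (z σ).im_pos

lemma moebius_im {M : GL (Fin 2) F} (hM : TotallyPositive M.1.det) (z : HilbertHalfSpace F)
    (σ : F →+* ℝ) : (moebius M z σ).im =
      σ M.1.det * (z σ).im / ‖(σ (M 1 0) : ℂ) * (z σ : ℂ) + (σ (M 1 1) : ℂ)‖ ^ 2 := by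
  have h : (realize σ M).det.val = σ M.1.det := by
    rw [RingHom.map_det]; rfl
  rw [moebius, UpperHalfPlane.im_smul_eq_div_normSq, h, abs_of_pos (hM σ), Complex.normSq_eq_norm_sq]
  rfl

lemma denom_norm_pos {M : GL (Fin 2) F} (z : HilbertHalfSpace F)
    (σ : F →+* ℝ) : 0 < ‖(σ (M 1 0) : ℂ) * (z σ : ℂ) + (σ (M 1 1) : ℂ)‖ :=
  norm_pos_iff.mpr (UpperHalfPlane.denom_ne_zero (realize σ M) (z σ))

/-- Since Im(Mz) = det(M) y / |cz + d|², the absolute value of the automorphy factor is exactly the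
change in ∏ y_σ^(k_σ/2). -/
lemma invNorm_slash (k : (F →+* ℝ) → ℤ) (φ : HilbertHalfSpace F → ℂ) {M : GL (Fin 2) F}
    (hM : TotallyPositive M.1.det) (z : HilbertHalfSpace F) :
    invNorm k (slash k φ M) z = invNorm k φ (moebius M z) := by
  rw [invNorm, invNorm, slash, norm_mul, mul_comm ‖autFactor k M z‖, mul_assoc, autFactor,
    norm_prod, ← Finset.prod_mul_distrib]
  congr 1
  refine Finset.prod_congr rfl fun σ _ => ?_
  have hn := denom_norm_pos (M := M) z σ
  have hdet := hM σ
  have hy := (z σ).im_pos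
  rw [moebius_im hM, norm_mul, norm_zpow, Complex.norm_real,
    Real.norm_of_nonneg (Real.rpow_nonneg hdet.le _)]
  generalize ‖(σ (M 1 0) : ℂ) * (z σ : ℂ) + (σ (M 1 1) : ℂ)‖ = n at hn
  rw [Real.div_rpow (by positivity) (by positivity), Real.mul_rpow hdet.le hy.le, zpow_neg,
    ← Real.rpow_natCast, ← Real.rpow_mul hn.le, ← Real.rpow_intCast]
  rw [show ((2 : ℕ) : ℝ) * ((k σ : ℝ) / 2) = k σ by push_cast; ring]
  field_simp

lemma norm_expTrace (ν : F) (z : HilbertHalfSpace F) :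
    ‖expTrace ν z‖ = ∏ σ : F →+* ℝ, Real.exp (-(2 * Real.pi * (σ ν * (z σ).im))) := by
  rw [expTrace, Complex.norm_exp, ← Real.exp_sum]
  congr 1
  rw [Finset.mul_sum, Complex.re_sum]
  refine Finset.sum_congr rfl fun σ _ => ?_
  simp [Complex.mul_re, Complex.mul_im]

/-- The excess power x^(κ-s) costs a factor exp x; as 2π > 2, a factor exp(-x) survives. -/
lemma rpow_mul_exp_le {κ s : ℝ} (h : s < κ) {x : ℝ} (hx : 0 < x) :
    x ^ κ * Real.exp (-(2 * Real.pi * x)) ≤ (κ - s) ^ (κ - s) * (x ^ s * Real.exp (-x)) := by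
  have h1 := rpow_le_mul_exp (sub_pos.mpr h) one_pos hx.le
  rw [div_one, one_mul] at h1
  have h2 : x ^ κ = x ^ (κ - s) * x ^ s := by
    rw [← Real.rpow_add hx, sub_add_cancel]
  have hκ : 0 < κ - s := sub_pos.mpr h
  calc x ^ κ * Real.exp (-(2 * Real.pi * x))
      ≤ ((κ - s) ^ (κ - s) * Real.exp x) * x ^ s * Real.exp (-(2 * x)) := by
        rw [h2]
        gcongr
        linarith [Real.pi_gt_three]
    _ = (κ - s) ^ (κ - s) * (x ^ s * (Real.exp x * Real.exp (-(2 * x)))) := by ring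
    _ = _ := by rw [← Real.exp_add]; ring_nf

lemma exp_neg_le_rpow {η x : ℝ} (hη : 0 < η) (hx : 0 < x) :
    Real.exp (-x) ≤ η ^ η * x ^ (-η) := by
  have h1 := rpow_le_mul_exp hη one_pos hx.le
  rw [div_one, one_mul] at h1
  have hxη : 0 < x ^ η := by positivity
  rw [Real.exp_neg, Real.rpow_neg hx.le, ← div_eq_mul_inv, le_div_iff₀ hxη,
    inv_mul_le_iff₀ (Real.exp_pos _)]
  linarith

/-! ### Growth of φ from its Fourier expansion -/

section TotallyReal

variable [IsTotallyReal F]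

lemma absTrace_pos {ν : F} (hν : TotallyPositive ν) : 0 < absTrace ν := by
  obtain ⟨σ⟩ := (inferInstance : Nonempty (F →+* ℝ))
  exact (abs_pos.mpr (hν σ).ne').trans_le (abs_le_absTrace ν σ)

/-- The bound for a single Fourier term at a balanced point. -/
lemma exists_fourier_term_le {k : (F →+* ℝ) → ℤ} (hk : ∀ σ, 2 < k σ) {δ η ε B : ℝ}
    (hδ1 : δ < 1 / 2) (hη : 0 < η) (hB : 0 < B) :
    ∃ C : ℝ, 0 ≤ C ∧ ∀ ν : F, TotallyPositive ν → ∀ z : HilbertHalfSpace F,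
      (∀ σ, imProd z ^ (1 / (Fintype.card (F →+* ℝ) : ℝ)) ≤ B * (z σ).im) →
      (∏ σ : F →+* ℝ, (σ ν) ^ ((k σ : ℝ) / 2 - 2 - ε)) * ‖expTrace ν z‖ *
        ∏ σ, (z σ).im ^ ((k σ : ℝ) / 2) ≤
      C * imProd z ^ (1 + δ - η / Fintype.card (F →+* ℝ)) *
        ((∏ σ : F →+* ℝ, σ ν) ^ (-(1 + ε - δ)) * absTrace ν ^ (-η)) := by
  set d := Fintype.card (F →+* ℝ) with hd
  have hk' : ∀ σ, 1 + δ < (k σ : ℝ) / 2 := fun σ => by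
    have : (3 : ℝ) ≤ k σ := by exact_mod_cast hk σ
    linarith
  let c : (F →+* ℝ) → ℝ := fun σ => ((k σ : ℝ) / 2 - (1 + δ)) ^ ((k σ : ℝ) / 2 - (1 + δ))
  have hc : ∀ σ, 0 ≤ c σ := fun σ => Real.rpow_nonneg (sub_nonneg.mpr (hk' σ).le) _
  have hc' : 0 ≤ ∏ σ, c σ := Finset.prod_nonneg fun σ _ => hc σ
  refine ⟨(∏ σ, c σ) * (η ^ η * B ^ η), by positivity, fun ν hν z hz => ?_⟩
  have hY := imProd_pos z
  have hN : 0 < ∏ σ : F →+* ℝ, σ ν := Finset.prod_pos fun σ _ => hν σ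
  have hT := absTrace_pos hν
  have hsum : imProd z ^ (1 / (d : ℝ)) / B * absTrace ν ≤ ∑ σ : F →+* ℝ, σ ν * (z σ).im := by
    rw [absTrace, Finset.mul_sum]
    refine Finset.sum_le_sum fun σ _ => ?_
    rw [abs_of_pos (hν σ), mul_comm]
    exact mul_le_mul_of_nonneg_left ((div_le_iff₀' hB).mpr (hz σ)) (hν σ).le
  calc _ = ∏ σ : F →+* ℝ, ((σ ν) ^ (-(2 + ε)) *
        ((σ ν * (z σ).im) ^ ((k σ : ℝ) / 2) *
          Real.exp (-(2 * Real.pi * (σ ν * (z σ).im))))) := by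
        rw [norm_expTrace, ← Finset.prod_mul_distrib, ← Finset.prod_mul_distrib]
        refine Finset.prod_congr rfl fun σ _ => ?_
        rw [Real.mul_rpow (hν σ).le (z σ).im_pos.le,
          show (k σ : ℝ) / 2 - 2 - ε = -(2 + ε) + (k σ : ℝ) / 2 by ring, Real.rpow_add (hν σ)]
        ring
    -- Replacing every k_σ/2 by the common exponent 1 + δ makes the estimate depend on y only
    -- through Y and the surviving exponential, even for non-parallel weight.
    _ ≤ ∏ σ : F →+* ℝ, ((σ ν) ^ (-(2 + ε)) *
        (c σ * ((σ ν * (z σ).im) ^ (1 + δ) * Real.exp (-(σ ν * (z σ).im))))) := by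
        refine Finset.prod_le_prod (fun σ _ => ?_) fun σ _ => ?_
        · have := mul_pos (hν σ) (z σ).im_pos
          have := hν σ
          positivity
        · exact mul_le_mul_of_nonneg_left
            (rpow_mul_exp_le (hk' σ) (mul_pos (hν σ) (z σ).im_pos))
            (Real.rpow_nonneg (hν σ).le _)
    _ = ∏ σ : F →+* ℝ, (c σ * ((σ ν) ^ (-(1 + ε - δ)) * ((z σ).im ^ (1 + δ) *
          Real.exp (-(σ ν * (z σ).im))))) := by
        refine Finset.prod_congr rfl fun σ _ => ?_
        rw [Real.mul_rpow (hν σ).le (z σ).im_pos.le,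
          show -(1 + ε - δ) = -(2 + ε) + (1 + δ) by ring, Real.rpow_add (hν σ) (-(2 + ε)) (1 + δ)]
        ring
    _ = (∏ σ, c σ) * ((∏ σ : F →+* ℝ, σ ν) ^ (-(1 + ε - δ)) * (imProd z ^ (1 + δ) *
          Real.exp (-∑ σ : F →+* ℝ, σ ν * (z σ).im))) := by
        rw [Finset.prod_mul_distrib, Finset.prod_mul_distrib, Finset.prod_mul_distrib,
          Real.finsetProd_rpow _ _ fun σ _ => (hν σ).le,
          Real.finsetProd_rpow _ _ fun σ _ => (z σ).im_pos.le, ← Real.exp_sum,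
          Finset.sum_neg_distrib, imProd]
    _ ≤ (∏ σ, c σ) * ((∏ σ : F →+* ℝ, σ ν) ^ (-(1 + ε - δ)) * (imProd z ^ (1 + δ) *
          (η ^ η * (imProd z ^ (1 / (d : ℝ)) / B * absTrace ν) ^ (-η)))) := by
        gcongr
        exact (Real.exp_le_exp.mpr (neg_le_neg hsum)).trans (exp_neg_le_rpow hη (by positivity))
    _ = _ := by
        rw [Real.mul_rpow (by positivity) hT.le, Real.div_rpow (by positivity) hB.le,
          ← Real.rpow_mul hY.le, Real.rpow_neg hB.le, div_inv_eq_mul,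
          show 1 + δ - η / d = (1 + δ) + 1 / d * -η by ring, Real.rpow_add hY (1 + δ)]
        ring

lemma imProd_rpow_le_of_balanced {κ : (F →+* ℝ) → ℝ} (hκ : ∀ σ, 0 ≤ κ σ) {B : ℝ} (hB : 0 < B)
    {z : HilbertHalfSpace F}
    (hz : ∀ σ, (z σ).im ≤ B * imProd z ^ (1 / (Fintype.card (F →+* ℝ) : ℝ))) :
    ∏ σ, (z σ).im ^ κ σ ≤
      B ^ (∑ σ, κ σ) * imProd z ^ ((∑ σ, κ σ) / Fintype.card (F →+* ℝ)) := by
  have hY := imProd_pos z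
  calc _ ≤ ∏ σ, (B * imProd z ^ (1 / (Fintype.card (F →+* ℝ) : ℝ))) ^ κ σ :=
        Finset.prod_le_prod (fun σ _ => Real.rpow_nonneg (z σ).im_pos.le _)
          fun σ _ => Real.rpow_le_rpow (z σ).im_pos.le (hz σ) (hκ σ)
    _ = _ := by
        rw [← Real.rpow_sum_of_pos (by positivity), Real.mul_rpow hB.le (by positivity),
          ← Real.rpow_mul hY.le]
        congr 2
        ring

/-- A function invariant under `Γ_∞` with Fourier coefficients of bounded growth satisfies
`|φ(z)| ∏ y_σ^{k_σ/2} ≤ C ((∏ y_σ)^{s₁} + (∏ y_σ)^{s₂})` at balanced points. -/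
lemma exists_invNorm_le_of_balanced {k : (F →+* ℝ) → ℤ} (hk : ∀ σ, 2 < k σ)
    {c : FractionalIdeal (𝓞 F)⁰ F} (hc : c ≠ 0) {φ : HilbertHalfSpace F → ℂ} {a : F → ℂ}
    (hφa : HasFourierExpansion c φ a) {ε : ℝ} (hε : 0 < ε) (ha : HasGrowth k c a ε)
    {B : ℝ} (hB : 0 < B) :
    ∃ C s₁ s₂ : ℝ, 0 ≤ C ∧ 1 < s₁ ∧ 1 < s₂ ∧ ∀ z : HilbertHalfSpace F,
      (∀ σ, (z σ).im ≤ B * imProd z ^ (1 / (Fintype.card (F →+* ℝ) : ℝ)) ∧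
        imProd z ^ (1 / (Fintype.card (F →+* ℝ) : ℝ)) ≤ B * (z σ).im) →
      invNorm k φ z ≤ C * (imProd z ^ s₁ + imProd z ^ s₂) := by
  classical
  obtain ⟨A, hA⟩ := ha
  set d := Fintype.card (F →+* ℝ) with hd
  have hdR : (0 : ℝ) < d := by exact_mod_cast card_embeddings_pos
  have hk3 : ∀ σ, (3 / 2 : ℝ) ≤ (k σ : ℝ) / 2 := fun σ => by
    have : (3 : ℝ) ≤ k σ := by exact_mod_cast hk σ
    linarith
  -- δ < ε makes the norm exponent 1 + ε - δ exceed 1; δ < 1/2 keeps 1 + δ below k_σ/2 ≥ 3/2.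
  obtain ⟨δ, hδ, hδε, hδ1⟩ : ∃ δ : ℝ, 0 < δ ∧ δ < ε ∧ δ < 1 / 2 := by
    obtain ⟨δ, h1, h2⟩ := exists_between (lt_min hε (by norm_num : (0 : ℝ) < 1 / 2))
    exact ⟨δ, h1, h2.trans_le (min_le_left _ _), h2.trans_le (min_le_right _ _)⟩
  -- The trace factor costs Y^(-η/d) = Y^(-δ/2), so the exponent of Y is 1 + δ/2, still above 1.
  set η : ℝ := d * δ / 2 with hη
  have hη0 : 0 < η := by positivity
  obtain ⟨C₁, hC₁, hterm⟩ := exists_fourier_term_le hk (ε := ε) hδ1 hη0 hB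
  rw [← hd, show 1 + δ - η / d = 1 + δ / 2 by rw [hη]; field_simp; ring] at hterm
  set s₂ := (∑ σ, (k σ : ℝ) / 2) / d with hs₂
  have hs₂' : 1 < s₂ := by
    rw [hs₂, lt_div_iff₀ hdR]
    calc (1 : ℝ) * d < 3 / 2 * d := by linarith
      _ = ∑ _σ : F →+* ℝ, (3 / 2 : ℝ) := by
        rw [Finset.sum_const, Finset.card_univ, nsmul_eq_mul, mul_comm]
      _ ≤ _ := Finset.sum_le_sum fun σ _ => hk3 σ
  -- The value 1 at ν = 0 lets one majorant cover the constant term too.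
  let G : F → ℝ := fun ν => if ν = 0 then 1 else
    (∏ σ : F →+* ℝ, σ ν) ^ (-(1 + ε - δ)) * absTrace ν ^ (-η)
  have hGpos : ∀ ν ∈ posPart c, G ν =
      (∏ σ : F →+* ℝ, σ ν) ^ (-(1 + ε - δ)) * absTrace ν ^ (-η) :=
    fun ν hν => if_neg hν.2.ne_zero
  have hG1 : Summable (G ∘ (↑) : posPart c → ℝ) := by
    refine (summable_prod_rpow_mul_absTrace_rpow hc (by linarith : 1 < 1 + ε - δ) hη0).congr ?_
    intro ν
    exact (hGpos ν ν.2).symm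
  have hG2 : Summable (G ∘ (↑) : ({0} : Set F) → ℝ) := (hasSum_fintype _).summable
  have hdisj : Disjoint (posPart c) ({0} : Set F) := by
    rw [Set.disjoint_singleton_right]
    exact fun h => h.2.ne_zero rfl
  have hG := hG1.hasSum.add_disjoint hdisj hG2.hasSum
  have hGnn : ∀ ν ∈ posPart c ∪ {0}, 0 ≤ G ν := by
    rintro ν (hν | rfl)
    · rw [hGpos ν hν]
      exact mul_nonneg (Real.rpow_nonneg (Finset.prod_nonneg fun σ _ => (hν.2 σ).le) _)
        (Real.rpow_nonneg (absTrace_nonneg _) _)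
    · simp [G]
  set S := ∑' ν : posPart c, (G ∘ (↑)) ν + ∑' ν : ({0} : Set F), (G ∘ (↑)) ν with hS
  have hS0 : 0 ≤ S := by
    refine add_nonneg (tsum_nonneg fun ν => hGnn _ (Or.inl ν.2))
      (tsum_nonneg fun ν => hGnn _ (Or.inr ν.2))
  set E := |A| * C₁ + ‖a 0‖ * B ^ (∑ σ, (k σ : ℝ) / 2) with hE
  have hE0 : 0 ≤ E := by positivity
  refine ⟨E * S, 1 + δ / 2, s₂, by positivity, by linarith, hs₂', fun z hz => ?_⟩
  have hY := imProd_pos z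
  set W := ∏ σ, (z σ).im ^ ((k σ : ℝ) / 2) with hW
  have hW0 : 0 < W := Finset.prod_pos fun σ _ => Real.rpow_pos_of_pos (z σ).im_pos _
  set V := imProd z ^ (1 + δ / 2) + imProd z ^ s₂ with hV
  have hV1 : imProd z ^ (1 + δ / 2) ≤ V := le_add_of_nonneg_right (by positivity)
  have hV2 : imProd z ^ s₂ ≤ V := le_add_of_nonneg_left (by positivity)
  have hV0 : 0 < V := by positivity
  have key : ∀ ν : (posPart c ∪ {0} : Set F), ‖a (ν : F) * expTrace (ν : F) z‖ ≤
      W⁻¹ * (E * V) * (G ∘ (↑)) ν := by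
    rintro ⟨ν, hν⟩
    rw [norm_mul, mul_assoc, le_inv_mul_iff₀ hW0, Function.comp]
    rcases hν with hν | hν
    · have h1 := hterm ν hν.2 z fun σ => (hz σ).2
      rw [← hGpos ν hν] at h1
      have hG0 := hGnn ν (Or.inl hν)
      have hP : 0 ≤ ∏ σ : F →+* ℝ, (σ ν) ^ ((k σ : ℝ) / 2 - 2 - ε) :=
        Finset.prod_nonneg fun σ _ => Real.rpow_nonneg (hν.2 σ).le _
      calc W * (‖a ν‖ * ‖expTrace ν z‖)
          ≤ W * ((|A| * ∏ σ : F →+* ℝ, (σ ν) ^ ((k σ : ℝ) / 2 - 2 - ε)) * ‖expTrace ν z‖) := by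
            gcongr
            exact (hA ν hν).trans (mul_le_mul_of_nonneg_right (le_abs_self A) hP)
        _ = |A| * ((∏ σ : F →+* ℝ, (σ ν) ^ ((k σ : ℝ) / 2 - 2 - ε)) * ‖expTrace ν z‖ * W) := by
            ring
        _ ≤ |A| * (C₁ * imProd z ^ (1 + δ / 2) * G ν) := by gcongr
        _ ≤ |A| * (C₁ * V * G ν) := by gcongr
        _ = (|A| * C₁) * V * G ν := by ring
        _ ≤ E * V * G ν := by
            gcongr
            exact le_add_of_nonneg_right (by positivity)
    · rw [Set.mem_singleton_iff] at hν
      subst hν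
      have h1 := imProd_rpow_le_of_balanced (κ := fun σ => (k σ : ℝ) / 2)
        (fun σ => by linarith [hk3 σ]) hB fun σ => (hz σ).1
      have h2 : ‖expTrace (0 : F) z‖ = 1 := by rw [norm_expTrace]; simp
      have h3 : G 0 = 1 := if_pos rfl
      change W * (‖a 0‖ * ‖expTrace (0 : F) z‖) ≤ E * V * G 0
      rw [h2, h3, mul_one, mul_one]
      calc W * ‖a 0‖ ≤ (B ^ (∑ σ, (k σ : ℝ) / 2) * imProd z ^ s₂) * ‖a 0‖ := by gcongr
        _ ≤ (B ^ (∑ σ, (k σ : ℝ) / 2) * V) * ‖a 0‖ := by gcongr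
        _ = (‖a 0‖ * B ^ (∑ σ, (k σ : ℝ) / 2)) * V := by ring
        _ ≤ E * V := by
            gcongr
            exact le_add_of_nonneg_left (by positivity)
  have hbound := (hφa z).norm_le_of_bounded (hG.mul_left (W⁻¹ * (E * V))) key
  calc invNorm k φ z = ‖φ z‖ * W := rfl
    _ ≤ W⁻¹ * (E * V) * S * W := by gcongr
    _ = _ := by field_simp

/-- Both `invNorm k φ` and Y are unchanged by diag(u², 1), the latter because u² has norm 1, so the
bound at balanced points holds everywhere. -/
lemma exists_invNorm_le {k : (F →+* ℝ) → ℤ} (hk : ∀ σ, 2 < k σ)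
    {c : FractionalIdeal (𝓞 F)⁰ F} (hc : c ≠ 0) {φ : HilbertHalfSpace F → ℂ} {a : F → ℂ}
    (hφa : HasFourierExpansion c φ a) (hφ : IsInvariant k c φ) {ε : ℝ} (hε : 0 < ε)
    (ha : HasGrowth k c a ε) :
    ∃ C s₁ s₂ : ℝ, 0 ≤ C ∧ 1 < s₁ ∧ 1 < s₂ ∧ ∀ z : HilbertHalfSpace F,
      invNorm k φ z ≤ C * (imProd z ^ s₁ + imProd z ^ s₂) := by
  obtain ⟨B, hB1, hB⟩ := exists_unit_sq_balanced F
  obtain ⟨C, s₁, s₂, hC, hs₁, hs₂, h⟩ :=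
    exists_invNorm_le_of_balanced hk hc hφa hε ha (zero_lt_one.trans_le hB1)
  refine ⟨C, s₁, s₂, hC, hs₁, hs₂, fun z => ?_⟩
  obtain ⟨u, hu⟩ := hB (fun σ => (z σ).im) fun σ => (z σ).im_pos
  have hu0 : ∀ σ : F →+* ℝ, 0 < σ (u : F) ^ 2 := fun σ =>
    sq_pos_of_ne_zero ((map_ne_zero σ).mpr (by simp))
  have hunit : IsTotPosUnit ((u : F) ^ 2) :=
    ⟨⟨u ^ 2, by simp⟩, fun σ => by rw [map_pow]; exact hu0 σ⟩
  let M : GL (Fin 2) F := Matrix.GeneralLinearGroup.mkOfDetNeZero !![(u : F) ^ 2, 0; 0, 1]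
    (by simp)
  have hMv : M.1 = !![(u : F) ^ 2, 0; 0, 1] := rfl
  have hMmem : M ∈ GammaInfty c := by
    refine (exists_cusp_iff c M).mpr ⟨(u : F) ^ 2, 1, 0, hunit, .one, zero_mem_ideal, ?_⟩
    rw [hMv]
    simp
  have hdet : M.1.det = (u : F) ^ 2 := by rw [hMv]; simp
  have hdet' : TotallyPositive M.1.det := by rw [hdet]; exact hunit.2
  have him : ∀ σ, (moebius M z σ).im = σ (u : F) ^ 2 * (z σ).im := by
    intro σ
    rw [moebius_im hdet', hdet, hMv]
    simp
  have hprod : imProd (moebius M z) = imProd z := by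
    rw [imProd, imProd]
    simp_rw [him]
    rw [Finset.prod_mul_distrib, Finset.prod_pow, ← sq_abs, Finset.abs_prod, prod_abs_unit,
      one_pow, one_mul]
  have h1 := h (moebius M z) fun σ => by
    rw [hprod, him]
    exact hu σ
  rwa [← invNorm_slash k φ hdet', hφ M hMmem, hprod] at h1

end TotallyReal

/-! ### Bottom rows, cosets and the majorant of the Poincaré series -/

/-- A locally bounded constant comparing `|c| + |d|` with `|cz + d|`. -/
noncomputable def denomConst (z : ℍ) : ℝ := 1 + (1 + ‖(z : ℂ)‖) / z.im

lemma continuous_denomConst : Continuous denomConst := by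
  unfold denomConst
  exact continuous_const.add ((continuous_const.add UpperHalfPlane.continuous_coe.norm).div₀
    UpperHalfPlane.continuous_im fun z => z.im_ne_zero)

lemma denomConst_pos (z : ℍ) : 0 < denomConst z := by
  have := z.im_pos
  unfold denomConst
  positivity

/-- The imaginary part of cz + d controls c, and the triangle inequality then controls d. -/
lemma abs_add_abs_le_denomConst (z : ℍ) (c d : ℝ) :
    |c| + |d| ≤ denomConst z * ‖(c : ℂ) * (z : ℂ) + (d : ℂ)‖ := by
  have hy := z.im_pos
  set n := ‖(c : ℂ) * (z : ℂ) + (d : ℂ)‖ with hn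
  have h1 : |c| * z.im ≤ n := by
    have := Complex.abs_im_le_norm ((c : ℂ) * (z : ℂ) + (d : ℂ))
    simpa [abs_mul, abs_of_pos hy] using this
  have h2 : |d| ≤ n + |c| * ‖(z : ℂ)‖ := by
    have := norm_sub_le ((c : ℂ) * (z : ℂ) + (d : ℂ)) ((c : ℂ) * (z : ℂ))
    rwa [add_sub_cancel_left, norm_mul, Complex.norm_real, Complex.norm_real, Real.norm_eq_abs,
      Real.norm_eq_abs] at this
  have h3 : |c| ≤ n / z.im := (le_div_iff₀ hy).mpr h1
  calc |c| + |d| ≤ n + |c| * (1 + ‖(z : ℂ)‖) := by linarith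
    _ ≤ n + n / z.im * (1 + ‖(z : ℂ)‖) := by gcongr
    _ = _ := by rw [denomConst]; ring

/-- `∏_σ (|σ(c)| + |σ(d)|)` for the bottom row `(c, d)` of `M`. -/
noncomputable def rowSize (M : GL (Fin 2) F) : ℝ :=
  ∏ σ : F →+* ℝ, (|σ (M 1 0)| + |σ (M 1 1)|)

lemma row_ne_zero (M : GL (Fin 2) F) : M 1 0 ≠ 0 ∨ M 1 1 ≠ 0 := by
  by_contra! h
  have h1 : M.1.det ≠ 0 := M.isUnit.map Matrix.detMonoidHom |>.ne_zero
  apply h1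
  rw [Matrix.det_fin_two]
  simp [h.1, h.2]

lemma rowSize_pos (M : GL (Fin 2) F) : 0 < rowSize M := by
  refine Finset.prod_pos fun σ _ => ?_
  rcases row_ne_zero M with h | h
  · have := abs_pos.mpr ((map_ne_zero σ).mpr h)
    positivity
  · have := abs_pos.mpr ((map_ne_zero σ).mpr h)
    positivity

section TotallyReal

variable [IsTotallyReal F]

lemma prod_totPosUnit {x : F} (hx : IsTotPosUnit x) : ∏ σ : F →+* ℝ, σ x = 1 := by
  rw [← hx.2.prod_abs]
  obtain ⟨⟨u, rfl⟩, -⟩ := hx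
  exact prod_abs_unit u

/-- The determinant is a totally positive unit, of norm 1, so Y(Mz) = Y(z) / ∏|cz + d|². -/
lemma imProd_moebius_le {M : GL (Fin 2) F} (hM : IsTotPosUnit M.1.det) (z : HilbertHalfSpace F) :
    imProd (moebius M z) ≤ imProd z * (∏ σ, denomConst (z σ)) ^ 2 * (rowSize M ^ 2)⁻¹ := by
  have hR := rowSize_pos M
  have hn : ∀ σ, 0 < ‖(σ (M 1 0) : ℂ) * (z σ : ℂ) + (σ (M 1 1) : ℂ)‖ :=
    fun σ => denom_norm_pos z σ
  have hnp := Finset.prod_pos fun σ (_ : σ ∈ Finset.univ) => hn σ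
  have h1 : rowSize M ≤ (∏ σ, denomConst (z σ)) *
      ∏ σ, ‖(σ (M 1 0) : ℂ) * (z σ : ℂ) + (σ (M 1 1) : ℂ)‖ := by
    rw [rowSize, ← Finset.prod_mul_distrib]
    exact Finset.prod_le_prod (fun σ _ => by positivity)
      fun σ _ => abs_add_abs_le_denomConst (z σ) _ _
  have h2 : imProd (moebius M z) = imProd z /
      (∏ σ, ‖(σ (M 1 0) : ℂ) * (z σ : ℂ) + (σ (M 1 1) : ℂ)‖) ^ 2 := by
    rw [imProd]
    simp_rw [moebius_im hM.2]
    rw [Finset.prod_div_distrib, Finset.prod_mul_distrib, prod_totPosUnit hM, one_mul,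
      Finset.prod_pow, imProd]
  have hY := imProd_pos z
  rw [h2, mul_assoc, div_eq_mul_inv]
  refine mul_le_mul_of_nonneg_left ?_ hY.le
  rw [← div_eq_mul_inv, le_div_iff₀ (by positivity), inv_mul_le_iff₀ (by positivity), ← mul_pow]
  rw [mul_comm] at h1
  exact pow_le_pow_left₀ hR.le h1 2

/-- Matrices in `Γ` whose bottom rows differ by a unit lie in the same coset of `Γ_∞`. -/
lemma mul_inv_mem_GammaInfty {c : FractionalIdeal (𝓞 F)⁰ F} {n : Ideal (𝓞 F)}
    {M N : GL (Fin 2) F} (hM : M ∈ Gamma0 c n) (hN : N ∈ Gamma0 c n) {u : F}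
    (hu : IsIntegralUnit u) (h0 : N 1 0 = u * M 1 0) (h1 : N 1 1 = u * M 1 1) :
    N * M⁻¹ ∈ GammaInfty c := by
  have hP : N * M⁻¹ ∈ Gamma0 c n := mul_mem hN (inv_mem hM)
  have hPM : N = (N * M⁻¹) * M := by simp
  obtain ⟨e1, e2, e3, e4⟩ := gl_inv_entries M
  have hdetM : M.1.det ≠ 0 := hM.2.2.2.2.1.ne_zero
  have p10 : (N * M⁻¹) 1 0 = 0 := by
    -- The bottom row of N is u times that of M, so NM⁻¹ has bottom row (0, u).
    rw [Units.val_mul, Matrix.mul_apply, Fin.sum_univ_two, e1, e3, h0, h1]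
    ring
  have p11 : (N * M⁻¹) 1 1 = u := by
    rw [Units.val_mul, Matrix.mul_apply, Fin.sum_univ_two, e2, e4, h0, h1]
    have : u * M 1 0 * (M.1.det⁻¹ * -M 0 1) + u * M 1 1 * (M.1.det⁻¹ * M 0 0) =
        u * (M.1.det⁻¹ * (M 0 0 * M 1 1 - M 0 1 * M 1 0)) := by ring
    rw [this, ← Matrix.det_fin_two, inv_mul_cancel₀ hdetM, mul_one]
  generalize N * M⁻¹ = P at hP p10 p11
  obtain ⟨-, -, hb, -, hdet⟩ := hP
  have hu0 := hu.ne_zero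
  have hdet2 : P.1.det = P 0 0 * u := by
    rw [Matrix.det_fin_two, p10, p11, mul_zero, sub_zero]
  rw [hdet2] at hdet
  have ha0 : P 0 0 ≠ 0 := left_ne_zero_of_mul hdet.1.ne_zero
  -- The quotient of the diagonal entries is det(P)/u², hence totally positive whatever the signs of
  -- u.
  have hinv : P 0 0 * u⁻¹ = (P 0 0 * u) * (u⁻¹ * u⁻¹) := by field_simp
  have haU : IsIntegralUnit (P 0 0) := by
    have := hdet.1.mul hu.inv
    rwa [mul_inv_cancel_right₀ hu0] at this
  refine (exists_cusp_iff c P).mpr ⟨P 0 0 * u⁻¹, u, (P 0 0)⁻¹ * P 0 1, ⟨?_, fun σ => ?_⟩, hu,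
    int_mul_mem haU.inv.mem_range hb, ?_⟩
  · exact haU.mul hu.inv
  · rw [hinv, map_mul]
    refine mul_pos (hdet.2 σ) ?_
    rw [map_mul]
    exact mul_self_pos.mpr ((map_ne_zero σ).mpr (inv_ne_zero hu0))
  · ext i j
    fin_cases i <;> fin_cases j <;> simp [p10, p11, hu0, ha0]

/-- The majorants `∏ (|c| + |d|)^{-2s}` of the Poincaré series are summable for `s > 1`. -/
lemma summable_rowSize_rpow {c : FractionalIdeal (𝓞 F)⁰ F} (hc : c ≠ 0) {n : Ideal (𝓞 F)}
    (hn : n ≠ ⊥) {s : ℝ} (hs : 1 < s) :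
    Summable fun q : Cosets c n => rowSize ((q.out : Gamma0 c n) : GL (Fin 2) F) ^ (-(2 * s)) := by
  have hI : idealCD c * (n : FractionalIdeal (𝓞 F)⁰ F) ≠ 0 := by
    refine mul_ne_zero (mul_ne_zero hc ?_) ?_
    · exact FractionalIdeal.coeIdeal_ne_zero.mpr differentIdeal_ne_bot
    · exact FractionalIdeal.coeIdeal_ne_zero.mpr hn
  -- The lower left entries lie in 𝔠𝔡𝔫, the lower right ones in 𝒪, which is the fractional ideal 1.
  refine summable_prod_add_rpow hI (one_ne_zero (α := FractionalIdeal (𝓞 F)⁰ F))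
    (fun q : Cosets c n => ((q.out : Gamma0 c n) : GL (Fin 2) F) 1 0)
    (fun q : Cosets c n => ((q.out : Gamma0 c n) : GL (Fin 2) F) 1 1)
    (fun q => q.out.2.2.2.2.1) (fun q => ?_) (fun q => row_ne_zero _) ?_ hs
  · rw [FractionalIdeal.mem_one_iff]
    exact q.out.2.2.1
  · intro i j u h0 h1
    have h2 : QuotientGroup.rightRel ((GammaInfty c).subgroupOf (Gamma0 c n)) j.out i.out :=
      QuotientGroup.rightRel_apply.mpr (Subgroup.mem_subgroupOf.mpr
        (mul_inv_mem_GammaInfty j.out.2 i.out.2 ⟨u, rfl⟩ h0 h1))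
    rw [← Quotient.out_eq i, ← Quotient.out_eq j]
    exact (Quotient.sound h2).symm

/-- The majorant separates into a continuous function of z and a summable function of the coset,
which gives pointwise and locally uniform convergence together. -/
lemma exists_poincareTerm_le {k : (F →+* ℝ) → ℤ} (hk : ∀ σ, 2 < k σ)
    {c : FractionalIdeal (𝓞 F)⁰ F} (hc : c ≠ 0) {n : Ideal (𝓞 F)} (hn : n ≠ ⊥)
    {φ : HilbertHalfSpace F → ℂ} {a : F → ℂ}
    (hφa : HasFourierExpansion c φ a) (hφ : IsInvariant k c φ) {ε : ℝ} (hε : 0 < ε)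
    (ha : HasGrowth k c a ε) :
    ∃ (A : HilbertHalfSpace F → ℝ) (b : Cosets c n → ℝ), Continuous A ∧ Summable b ∧
      (∀ q, 0 ≤ b q) ∧ ∀ q z, ‖poincareTerm k c n φ hφ q z‖ ≤ A z * b q := by
  obtain ⟨C, s₁, s₂, hC, hs₁, hs₂, h⟩ := exists_invNorm_le hk hc hφa hφ hε ha
  let Q : HilbertHalfSpace F → ℝ := fun z => imProd z * (∏ σ, denomConst (z σ)) ^ 2
  let W : HilbertHalfSpace F → ℝ := fun z => ∏ σ, (z σ).im ^ ((k σ : ℝ) / 2)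
  have hQ : ∀ z, 0 < Q z := fun z => mul_pos (imProd_pos z)
    (pow_pos (Finset.prod_pos fun σ _ => denomConst_pos (z σ)) 2)
  have hW : ∀ z, 0 < W z := fun z =>
    Finset.prod_pos fun σ _ => Real.rpow_pos_of_pos (z σ).im_pos _
  have him : ∀ σ : F →+* ℝ, Continuous fun z : HilbertHalfSpace F => (z σ).im := fun σ =>
    UpperHalfPlane.continuous_im.comp (continuous_apply σ)
  have hQc : Continuous Q := (continuous_finsetProd _ fun σ _ => him σ).mul
    ((continuous_finsetProd _ fun σ _ =>
      continuous_denomConst.comp (continuous_apply σ)).pow 2)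
  have hWc : Continuous W := continuous_finsetProd _ fun σ _ =>
    (him σ).rpow_const fun z => Or.inl (z σ).im_ne_zero
  refine ⟨fun z => C * (Q z ^ s₁ + Q z ^ s₂) / W z,
    fun q => rowSize ((q.out : Gamma0 c n) : GL (Fin 2) F) ^ (-(2 * s₁)) +
      rowSize ((q.out : Gamma0 c n) : GL (Fin 2) F) ^ (-(2 * s₂)), ?_,
    (summable_rowSize_rpow hc hn hs₁).add (summable_rowSize_rpow hc hn hs₂), fun q => ?_,
    fun q z => ?_⟩
  · exact (continuous_const.mul ((hQc.rpow_const fun z => Or.inl (hQ z).ne').add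
      (hQc.rpow_const fun z => Or.inl (hQ z).ne'))).div₀ hWc fun z => (hW z).ne'
  · have := rowSize_pos ((q.out : Gamma0 c n) : GL (Fin 2) F)
    positivity
  have hq : poincareTerm k c n φ hφ q = slash k φ ((q.out : Gamma0 c n) : GL (Fin 2) F) := by
    conv_lhs => rw [← Quotient.out_eq q]
    rfl
  have hdet := q.out.2.2.2.2.2
  have hR := rowSize_pos ((q.out : Gamma0 c n) : GL (Fin 2) F)
  rw [hq]
  beta_reduce
  generalize ((q.out : Gamma0 c n) : GL (Fin 2) F) = M at hdet hR ⊢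
  have h1 : ‖slash k φ M z‖ * W z ≤
      C * (imProd (moebius M z) ^ s₁ + imProd (moebius M z) ^ s₂) := by
    refine le_trans (le_of_eq ?_) (h (moebius M z))
    rw [← invNorm_slash k φ hdet.2]
    rfl
  have h2 : ∀ s : ℝ, 1 < s → imProd (moebius M z) ^ s ≤ Q z ^ s * rowSize M ^ (-(2 * s)) := by
    intro s hs
    refine (Real.rpow_le_rpow (imProd_pos _).le (imProd_moebius_le hdet z) (by linarith)).trans
      (le_of_eq ?_)
    rw [Real.mul_rpow (hQ z).le (by positivity), ← Real.rpow_natCast, ← Real.rpow_neg hR.le,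
      ← Real.rpow_mul hR.le]
    congr 2
    push_cast
    ring
  have g1 : 0 ≤ rowSize M ^ (-(2 * s₁)) := by positivity
  have g2 : 0 ≤ rowSize M ^ (-(2 * s₂)) := by positivity
  have g3 : 0 ≤ Q z ^ s₁ := Real.rpow_nonneg (hQ z).le _
  have g4 : 0 ≤ Q z ^ s₂ := Real.rpow_nonneg (hQ z).le _
  rw [div_mul_eq_mul_div, le_div_iff₀ (hW z), mul_assoc]
  refine h1.trans (mul_le_mul_of_nonneg_left ?_ hC)
  calc _ ≤ Q z ^ s₁ * rowSize M ^ (-(2 * s₁)) + Q z ^ s₂ * rowSize M ^ (-(2 * s₂)) :=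
        add_le_add (h2 s₁ hs₁) (h2 s₂ hs₂)
    -- The product of the two sums exceeds the left side by its cross terms, which are nonnegative.
    _ ≤ _ := by nlinarith [mul_nonneg g3 g2, mul_nonneg g4 g1]

end TotallyReal

end HilbertPoincare

theorem mainTheorem10 {F : Type*} [Field F] [NumberField F] [NumberField.IsTotallyReal F]
    (hd : 1 < Module.finrank ℚ F)
    (k : (F →+* ℝ) → ℤ) (hk : ∀ σ, 2 < k σ)
    (c : FractionalIdeal (nonZeroDivisors (NumberField.RingOfIntegers F)) F) (hc : c ≠ 0)
    (n : Ideal (NumberField.RingOfIntegers F)) (hn : n ≠ ⊥)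
    (φ : HilbertPoincare.HilbertHalfSpace F → ℂ) (a : F → ℂ)
    (hφa : HilbertPoincare.HasFourierExpansion c φ a)
    (hφ : HilbertPoincare.IsInvariant k c φ)
    (ε : ℝ) (hε : 0 < ε) (ha : HilbertPoincare.HasGrowth k c a ε) :
    (∀ z : HilbertPoincare.HilbertHalfSpace F,
      Summable fun M : HilbertPoincare.Cosets c n =>
        ‖HilbertPoincare.poincareTerm k c n φ hφ M z‖) ∧
    HasSumLocallyUniformly (HilbertPoincare.poincareTerm k c n φ hφ)
      (HilbertPoincare.poincareSeries k c n φ hφ) := by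
  obtain ⟨A, b, hA, hb, hb0, h⟩ :=
    HilbertPoincare.exists_poincareTerm_le hk hc hn hφa hφ hε ha
  refine ⟨fun z => Summable.of_nonneg_of_le (fun _ => norm_nonneg _) (fun q => h q z)
    (hb.mul_left (A z)), ?_⟩
  refine hasSumLocallyUniformly_of_of_forall_exists_nhds fun z => ?_
  -- On this neighbourhood the continuous factor is bounded by a constant, so the Weierstrass test
  -- applies.
  refine ⟨{w | A w < A z + 1}, (isOpen_lt hA continuous_const).mem_nhds (by simp), ?_⟩
  refine HasSumUniformlyOn.of_norm_le_summable (hb.mul_left (A z + 1)) fun q w hw => ?_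
  exact (h q w).trans (mul_le_mul_of_nonneg_right (le_of_lt hw) (hb0 q))
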